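/- **Scene.** A scene consists of a wall, the vertical line $x=n$, and a set of axis-parallel rectangular obstacles with width and height at least $1$, with integral $x$-coordinates of the corners, and with pairwise disjoint interiors (they may touch, and a point robot may move along boundaries and squeeze between touching obstacles). Let $\tau>0$ and let $k,M\ge 1$ be integers. A $\tau$-post is a vertical portion of height $2\tau$ of the left edge of an obstacle; it is identified with its center. **$\tau$-paths.** A $\tau$-path is the path of the robot moving right along a line $y=y_0$ as follows: if it hits an obstacle whose nearest corner (either one, in case of a tie) is less than $\tau$ away, it goes around that corner to the point on the opposite side with $y$-coordinate $y_0$ and continues to the right; if it hits a $\tau$-post (centered at height $y_0$) or the wall, it stops. An up-edge (down-edge) from a post $P$ to a post $P'$ goes vertically from $P$ to the top (bottom) of $P$, and then along a $\tau$-path to $P'$; then $P'$ is the up-child (down-child) of $P$. There is no such child if the $\tau$-path hits the wall. **Fence-tree.** The $k\times M$ $\tau$-fence-tree with root $P_1^1$ has as nodes $\tau$-posts $P_i^m=(X_i^m,Y_i^m)$, $1\le i\le k$, $1\le m\le M$, all to the left of the wall, such that: for $m\ge2$, $P_1^m$ is the up-child of $P_1^{m-1}$; for $i\ge 2$, $P_i^1$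 is the down-child of $P_{i-1}^1$; for $i,m\ge 2$, $P_i^m$ is the down-child of $P_{i-1}^m$ if $X_{i-1}^m>X_i^{m-1}$, and the up-child of $P_i^{m-1}$ otherwise. Its edges are the corresponding up- and down-edges. The posts $P_i^1,\dots,P_i^M$ form the fence $F_i$. **Procedure FindFenceTree.** The robot starts at a given $\tau$-post $P_1^1=(x_0,y_0)$ with $0<x_0<n$. The variables are the current fence $i$ (initially $1$) and, for each fence $F_j$, the number $M_j$ of posts found and the coordinates $(X_j,Y_j)$ of the last post found; initially $M_1=1$, $(X_1,Y_1)=(x_0,y_0)$, and $M_j=X_j=0$ for $j>1$. Repeatedly, the first case that applies is executed: 1. $i<k$, $X_i>X_{i+1}$ and $M_i>M_{i+1}+1$: call GoBackDown$(i,M_i,M_{i+1})$; $i\leftarrow i+1$. 2. $i<k$ and $X_i>X_{i+1}$: go down $\tau$ and then right on a $\tau$-path to a $\tau$-post; halt if the wall is reached; otherwise $M_{i+1}\leftarrow M_{i+1}+1$, $(X_{i+1},Y_{i+1})\leftarrow$ the current position, $i\leftarrow i+1$. 3. $i=1$ and $M_i<M$; or $i>1$ and $M_{i-1}>M_i+1$;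 or $i>1$, $M_{i-1}=M_i+1$ and $X_{i-1}\le X_i$: go up $\tau$ and then right on a $\tau$-path to a $\tau$-post; halt if the wall is reached; otherwise $M_i\leftarrow M_i+1$, $(X_i,Y_i)\leftarrow$ the current position. 4. $i<k$, $M_i>M_{i+1}$, and either $M_i=M$ or there is $u<i$ with $M_u=M_i+1$ and $X_u>X_{i+1}$: call GoDown$(i,M_i,M_{i+1})$; $i\leftarrow i+1$. 5. $i=k$ and $M_i=M$: halt. 6. Otherwise: return to the last post of $F_{i-1}$ by the last path that was used to get from there to the current point; $i\leftarrow i-1$. *Greedy* down-left motion means: move down until an obstacle is hit, then left to its corner, and repeat; greedy right-down motion means: move right until an obstacle is hit, then down to its corner, and repeat. In the two subroutines, $P_i^m$ is the $m$-th post found on $F_i$, and tree paths are paths of traversed edges. *GoDown$(i,m,q)$*, called at a point $(x,y)$ with $m\ge q$, $X_i^m\le x\le X_{i+1}^q$ and $Y_i^m\ge y\ge Y_{i+1}^q$: go greedy down-left until $y\le Y_{i+1}^q+\tau$; then go greedy right-down until the post $P_{i+1}^q$ is touched (then move along it to its center and return) or the tree path from the root to $P_{i+1}^q$ is hit; in the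 latter case follow this tree path to $P_{i+1}^q$. *GoBackDown$(i,m,q)$*, called at $P_i^m$ with $m\ge q+2$ and $X_i^m>X_{i+1}^q\ge X_i^{m-1}$: follow the tree path from the root to $P_i^m$ backward until $x=X_{i+1}^q$; then go greedy down-left until either the current point is in the closed rectangle with opposite corners $P_j^{m-1}$ and $P_{j+1}^{m-1}$ for some $1\le j<i$, in which case call GoDown$(j',m-1,m-1)$ for $j'=j,\dots,i-1$ in turn, or $y=Y_i^{m-1}$; finally call GoDown$(i,m-1,q)$. **Theorem 3.** For every scene, all $\tau>0$ and $k,M\ge1$, and every starting $\tau$-post $P_1^1=(x_0,y_0)$ with $0<x_0<n$, FindFenceTree terminates: every action can be carried out (in particular the subroutines are only called under their stated conditions, and they end), there is no infinite run, and so the procedure halts. If the robot is not at the wall when it halts, then the $k\times M$ $\tau$-fence-tree with root $P_1^1$ exists, its nodes $P_i^m$ are unique, the robot is at the post $P_k^M$, and it has visited every node and traversed every edge of this tree. -/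

import Mathlib

namespace Nav

/-! ### Scenes -/

abbrev Point := ℝ × ℝ

/-- An axis-parallel rectangle with integral `x`-coordinates and width and height at least `1`. -/
structure Obstacle where
  left : ℤ
  right : ℤ
  bottom : ℝ
  top : ℝ
  one_le_width : left + 1 ≤ right
  one_le_height : bottom + 1 ≤ top

def Obstacle.interior (R : Obstacle) : Set Point :=
  {p | (R.left : ℝ) < p.1 ∧ p.1 < (R.right : ℝ) ∧ R.bottom < p.2 ∧ p.2 < R.top}

/-- A scene: the wall is the vertical line `x = n`; obstacles do not overlap, but may touch. -/
structure Scene where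
  n : ℝ
  obstacles : Set Obstacle
  nonoverlapping : obstacles.Pairwise fun R R' => Disjoint R.interior R'.interior

/-- The robot can be at every point of `A`: no such point is behind the wall or inside an obstacle.
The robot may move along the boundary of an obstacle, and squeeze between touching obstacles. -/
def Scene.Free (S : Scene) (A : Set Point) : Prop :=
  ∀ p ∈ A, p.1 ≤ S.n ∧ ∀ R ∈ S.obstacles, p ∉ R.interior

/-- A robot at `p` that tries to move to the right is stopped by the left edge of `R`. -/
def Obstacle.BlocksRight (R : Obstacle) (p : Point) : Prop :=
  p.1 = (R.left : ℝ) ∧ R.bottom < p.2 ∧ p.2 < R.top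

/-- A robot at `p` that tries to move down is stopped by the top edge of `R`. -/
def Obstacle.BlocksDown (R : Obstacle) (p : Point) : Prop :=
  p.2 = R.top ∧ (R.left : ℝ) < p.1 ∧ p.1 < (R.right : ℝ)

/-- `p` is the center of a `τ`-post: a portion of height `2τ` of the left edge of an obstacle. -/
def Scene.IsPost (S : Scene) (τ : ℝ) (p : Point) : Prop :=
  ∃ R ∈ S.obstacles, p.1 = (R.left : ℝ) ∧ R.bottom ≤ p.2 - τ ∧ p.2 + τ ≤ R.top

/-- The points of the `τ`-post with center `p`. -/
def postSegment (τ : ℝ) (p : Point) : Set Point :=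
  {z | z.1 = p.1 ∧ p.2 - τ ≤ z.2 ∧ z.2 ≤ p.2 + τ}

/-! ### Paths

A path is the list of its successive corners (repetitions are allowed); the robot moves straight
from each one to the next. -/

/-- The points of a path. -/
def trace (l : List Point) : Set Point :=
  {z | ∃ u v, [u, v] <:+: l ∧ z ∈ segment ℝ u v}

/-- `c` is the height of a corner of `R` that is nearest to the point at height `y` of its left
edge (either corner, in case of a tie). -/
def Obstacle.NearestCorner (R : Obstacle) (y c : ℝ) : Prop :=
  (c = R.top ∧ R.top - y ≤ y - R.bottom) ∨ (c = R.bottom ∧ y - R.bottom ≤ R.top - y)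

/-- `TauPath S τ p l e`: `l` is a `τ`-path that starts at `p`; it ends at `e`, which is either the
center of a `τ`-post before the wall, or a point of the wall. -/
inductive TauPath (S : Scene) (τ : ℝ) : Point → List Point → Point → Prop
  | wall (p : Point) : p.1 = S.n → TauPath S τ p [p] p
  | post (p : Point) : p.1 < S.n → S.IsPost τ p → TauPath S τ p [p] p
  /-- nothing in the way: move to the right until the wall or an obstacle is hit -/
  | ahead (p q : Point) (l : List Point) (e : Point) :
      p.1 < S.n → ¬ S.IsPost τ p → (∀ R ∈ S.obstacles, ¬ R.BlocksRight p) →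
      p.1 < q.1 → q.2 = p.2 → S.Free (segment ℝ p q) →
      (q.1 = S.n ∨ ∃ R ∈ S.obstacles, R.BlocksRight q) →
      TauPath S τ q l e → TauPath S τ p (p :: l) e
  /-- an obstacle whose nearest corner is less than `τ` away: go around that corner to the
  opposite point -/
  | around (p : Point) (R : Obstacle) (c : ℝ) (l : List Point) (e : Point) :
      p.1 < S.n → ¬ S.IsPost τ p → R ∈ S.obstacles → R.BlocksRight p →
      R.NearestCorner p.2 c → |c - p.2| < τ → (R.right : ℝ) < S.n →
      TauPath S τ ((R.right : ℝ), p.2) l e →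
      TauPath S τ p (p :: ((R.left : ℝ), c) :: ((R.right : ℝ), c) :: l) e
  /-- the wall is hit while going around an obstacle -/
  | aroundWall (p : Point) (R : Obstacle) (c : ℝ) :
      p.1 < S.n → ¬ S.IsPost τ p → R ∈ S.obstacles → R.BlocksRight p →
      R.NearestCorner p.2 c → |c - p.2| < τ → S.n ≤ (R.right : ℝ) →
      TauPath S τ p [p, ((R.left : ℝ), c), (S.n, c)] (S.n, c)

/-- `path` goes from `P` up to the top of the `τ`-post `P`, and then on a `τ`-path to `P'`. -/
def UpEdge (S : Scene) (τ : ℝ) (P : Point) (path : List Point) (P' : Point) : Prop :=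
  ∃ l, TauPath S τ (P.1, P.2 + τ) l P' ∧ path = P :: l

/-- `path` goes from `P` down to the bottom of the `τ`-post `P`, and then on a `τ`-path to `P'`. -/
def DownEdge (S : Scene) (τ : ℝ) (P : Point) (path : List Point) (P' : Point) : Prop :=
  ∃ l, TauPath S τ (P.1, P.2 - τ) l P' ∧ path = P :: l

/-! ### The fence-tree -/

/-- In a tree with nodes `P i m` (fence `i`, post `m`, both counted from `1`), `path` is the edge
from the parent of the node `P i m` to this node, where `(i, m) ≠ (1, 1)`. -/
def EdgeInto (S : Scene) (τ : ℝ) (P : ℕ → ℕ → Point) (i m : ℕ) (path : List Point) : Prop :=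
  (i = 1 ∧ UpEdge S τ (P 1 (m - 1)) path (P 1 m)) ∨
  (i ≠ 1 ∧ m = 1 ∧ DownEdge S τ (P (i - 1) 1) path (P i 1)) ∨
  (i ≠ 1 ∧ m ≠ 1 ∧ (P i (m - 1)).1 < (P (i - 1) m).1 ∧
    DownEdge S τ (P (i - 1) m) path (P i m)) ∨
  (i ≠ 1 ∧ m ≠ 1 ∧ (P (i - 1) m).1 ≤ (P i (m - 1)).1 ∧
    UpEdge S τ (P i (m - 1)) path (P i m))

/-- The `P i m` with `1 ≤ i ≤ k` and `1 ≤ m ≤ M` are the nodes of the `k × M` `τ`-fence-tree with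
root `P₀`. -/
def IsFenceTree (S : Scene) (τ : ℝ) (k M : ℕ) (P₀ : Point) (P : ℕ → ℕ → Point) : Prop :=
  P 1 1 = P₀ ∧
  (∀ i ∈ Finset.Icc 1 k, ∀ m ∈ Finset.Icc 1 M, (P i m).1 < S.n ∧ S.IsPost τ (P i m)) ∧
  ∀ i ∈ Finset.Icc 1 k, ∀ m ∈ Finset.Icc 1 M, (i, m) ≠ (1, 1) → ∃ path, EdgeInto S τ P i m path

/-! ### Greedy motion -/

/-- Greedy motion from `p` to the first point `e` that lies in `goal`: move in the direction `dir`
until an obstacle is hit, then slide along it to its corner, and repeat.  `hit p c` says that the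
robot is stopped at `p` by an obstacle, and that `c` is the corner to which it then slides. -/
inductive Greedy (S : Scene) (dir : Point) (hit : Point → Point → Prop) (goal : Set Point) :
    Point → List Point → Point → Prop
  | done (p : Point) : p ∈ goal → Greedy S dir hit goal p [p] p
  | ahead (p q : Point) (l : List Point) (e : Point) :
      p ∉ goal → (∀ c, ¬ hit p c) → (∃ s : ℝ, 0 < s ∧ q = p + s • dir) →
      S.Free (segment ℝ p q) → (∀ z ∈ segment ℝ p q, z ≠ q → z ∉ goal) →
      (q ∈ goal ∨ ∃ c, hit q c) →
      Greedy S dir hit goal q l e → Greedy S dir hit goal p (p :: l) e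
  | slide (p c q : Point) (l : List Point) (e : Point) :
      p ∉ goal → hit p c → q ∈ segment ℝ p c → q ≠ p →
      (∀ z ∈ segment ℝ p q, z ≠ q → z ∉ goal) → (q ∈ goal ∨ q = c) →
      Greedy S dir hit goal q l e → Greedy S dir hit goal p (p :: l) e

/-- Greedy down-left: down until an obstacle is hit, left to its corner, and so on. -/
def GreedyDownLeft (S : Scene) (goal : Set Point) : Point → List Point → Point → Prop :=
  Greedy S (0, -1)
    (fun p c => ∃ R ∈ S.obstacles, R.BlocksDown p ∧ c = ((R.left : ℝ), R.top)) goal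

/-- Greedy right-down: right until an obstacle is hit, down to its corner, and so on. -/
def GreedyRightDown (S : Scene) (goal : Set Point) : Point → List Point → Point → Prop :=
  Greedy S (1, 0)
    (fun p c => ∃ R ∈ S.obstacles, R.BlocksRight p ∧ c = ((R.left : ℝ), R.bottom)) goal

/-- `l` is the rest of `path` from its point `b` on. -/
def RestFrom (path : List Point) (b : Point) (l : List Point) : Prop :=
  ∃ pre u v suf, path = pre ++ u :: v :: suf ∧ b ∈ segment ℝ u v ∧ l = b :: v :: suf

/-- `l` is `path` up to its first point `a` with `x`-coordinate `c`. -/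
def FollowUntil (path : List Point) (c : ℝ) (l : List Point) (a : Point) : Prop :=
  ∃ pre u v suf, path = pre ++ u :: v :: suf ∧ a ∈ segment ℝ u v ∧ a.1 = c ∧
    l = pre ++ [u, a] ∧ ∀ z ∈ trace l, z.1 = c → z = a

/-! ### The procedures `GoDown` and `GoBackDown`

`post i m` is the center of the `m`-th post of the `i`-th fence, and `branch i m` the tree path
from the root to this post, as recorded by the robot.  `GoDown … p path e` says that a call with
the robot at `p` makes it walk along `path` to `e`.  The stated initial conditions of the
procedures are part of the definitions: a call that violates them cannot be carried out. -/

def GoDown (S : Scene) (τ : ℝ) (post : ℕ → ℕ → Point) (branch : ℕ → ℕ → List Point)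
    (i m q : ℕ) (p : Point) (path : List Point) (e : Point) : Prop :=
  (q ≤ m ∧ (post i m).1 ≤ p.1 ∧ p.1 ≤ (post (i + 1) q).1 ∧
    (post (i + 1) q).2 ≤ p.2 ∧ p.2 ≤ (post i m).2) ∧
  ∃ l₁ a l₂ b l₃,
    GreedyDownLeft S {z | z.2 ≤ (post (i + 1) q).2 + τ} p l₁ a ∧
    GreedyRightDown S (postSegment τ (post (i + 1) q) ∪ trace (branch (i + 1) q)) a l₂ b ∧
    ((b ∈ postSegment τ (post (i + 1) q) ∧ l₃ = [b, post (i + 1) q]) ∨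
      RestFrom (branch (i + 1) q) b l₃) ∧
    path = l₁ ++ l₂ ++ l₃ ∧ l₃.getLast? = some e

/-- The calls `GoDown (j, m, m)` for `j, j + 1, …, i - 1`. -/
inductive GoDownTo (S : Scene) (τ : ℝ) (post : ℕ → ℕ → Point) (branch : ℕ → ℕ → List Point)
    (i m : ℕ) : ℕ → Point → List Point → Point → Prop
  | done (p : Point) : GoDownTo S τ post branch i m i p [p] p
  | call (j : ℕ) (p : Point) (l : List Point) (p' : Point) (l' : List Point) (e : Point) :
      j < i → GoDown S τ post branch j m m p l p' →
      GoDownTo S τ post branch i m (j + 1) p' l' e →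
      GoDownTo S τ post branch i m j p (l ++ l') e

/-- The rectangular region whose opposite corners are the `m`-th posts of the fences `j` and
`j + 1`. -/
def region (post : ℕ → ℕ → Point) (m j : ℕ) : Set Point :=
  Set.uIcc (post j m) (post (j + 1) m)

def GoBackDown (S : Scene) (τ : ℝ) (post : ℕ → ℕ → Point) (branch : ℕ → ℕ → List Point)
    (i m q : ℕ) (p : Point) (path : List Point) (e : Point) : Prop :=
  (p = post i m ∧ q + 2 ≤ m ∧ (post (i + 1) q).1 < (post i m).1 ∧
    (post i (m - 1)).1 ≤ (post (i + 1) q).1) ∧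
  ∃ l₁ a l₂ b l₃ b' l₄,
    FollowUntil (branch i m).reverse (post (i + 1) q).1 l₁ a ∧
    GreedyDownLeft S
      {z | (∃ j, 1 ≤ j ∧ j < i ∧ z ∈ region post (m - 1) j) ∨ z.2 = (post i (m - 1)).2} a l₂ b ∧
    ((∃ j, 1 ≤ j ∧ j < i ∧ b ∈ region post (m - 1) j ∧
        GoDownTo S τ post branch i (m - 1) j b l₃ b') ∨
      ((∀ j, 1 ≤ j → j < i → b ∉ region post (m - 1) j) ∧ l₃ = [] ∧ b' = b)) ∧
    GoDown S τ post branch i (m - 1) q b' l₄ e ∧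
    path = l₁ ++ l₂ ++ l₃ ++ l₄

/-! ### The procedure `FindFenceTree` -/

structure State where
  /-- the current fence -/
  i : ℕ
  /-- the number of posts found so far on each fence -/
  M : ℕ → ℕ
  /-- the coordinates of the last post found on each fence -/
  X : ℕ → ℝ
  Y : ℕ → ℝ
  /-- the position of the robot -/
  pos : Point
  /-- the whole path walked so far -/
  walk : List Point
  /-- the posts found so far -/
  post : ℕ → ℕ → Point
  /-- the path of traversed edges from the root to each post found so far -/
  branch : ℕ → ℕ → List Point
  /-- the last path by which the robot got from the last post of the fence above `F_j` to the
  last post of `F_j` -/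
  trail : ℕ → List Point
  halted : Bool

namespace State

def init (P₀ : Point) : State where
  i := 1
  M := fun j => if j = 1 then 1 else 0
  X := fun j => if j = 1 then P₀.1 else 0
  Y := fun j => if j = 1 then P₀.2 else 0
  pos := P₀
  walk := [P₀]
  post := fun _ _ => P₀
  branch := fun _ _ => [P₀]
  trail := fun _ => [P₀]
  halted := false

/-- Case 1: the current fence is ahead of the next lower one, which can be extended from itself. -/
def Case1 (k : ℕ) (σ : State) : Prop :=
  σ.i < k ∧ σ.X (σ.i + 1) < σ.X σ.i ∧ σ.M (σ.i + 1) + 1 < σ.M σ.i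

/-- Case 2: the current fence is ahead of the next lower one. -/
def Case2 (k : ℕ) (σ : State) : Prop :=
  σ.i < k ∧ σ.X (σ.i + 1) < σ.X σ.i

/-- Case 3: the current fence can be extended from itself. -/
def Case3 (M : ℕ) (σ : State) : Prop :=
  (σ.i = 1 ∧ σ.M σ.i < M) ∨
  (1 < σ.i ∧ (σ.M σ.i + 1 < σ.M (σ.i - 1) ∨
    (σ.M (σ.i - 1) = σ.M σ.i + 1 ∧ σ.X (σ.i - 1) ≤ σ.X σ.i)))

/-- Case 4: the next lower fence can be extended from itself, and the current fence is completed
or its next post is known to be ahead of the last post of the next lower fence. -/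
def Case4 (k M : ℕ) (σ : State) : Prop :=
  σ.i < k ∧ σ.M (σ.i + 1) < σ.M σ.i ∧
  (σ.M σ.i = M ∨
    ∃ u, 1 ≤ u ∧ u < σ.i ∧ σ.M u = σ.M σ.i + 1 ∧ σ.X (σ.i + 1) < σ.X u)

/-- Case 5: the last post of the lowest fence has been found. -/
def Case5 (k M : ℕ) (σ : State) : Prop :=
  σ.i = k ∧ σ.M σ.i = M

/-- The robot goes down to the next lower fence along `path`, which ends at `p`. -/
def goDown (σ : State) (path : List Point) (p : Point) : State :=
  { σ with
    i := σ.i + 1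
    pos := p
    walk := σ.walk ++ path
    trail := Function.update σ.trail (σ.i + 1) path }

/-- The robot traverses a new edge `path` from the last post of the current fence to the new post
`p` of the fence `j`, which becomes the current fence; `t` is the new value of `trail j`. -/
def addPost (σ : State) (j : ℕ) (path : List Point) (p : Point) (t : List Point) : State :=
  { σ with
    i := j
    M := Function.update σ.M j (σ.M j + 1)
    X := Function.update σ.X j p.1
    Y := Function.update σ.Y j p.2
    pos := p
    walk := σ.walk ++ path
    post := Function.update σ.post j (Function.update (σ.post j) (σ.M j + 1) p)
    branch := Function.update σ.branch j
      (Function.update (σ.branch j) (σ.M j + 1) (σ.branch σ.i (σ.M σ.i) ++ path))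
    trail := Function.update σ.trail j t }

/-- The robot walks along `path` to the point `p` of the wall, and halts. -/
def hitWall (σ : State) (path : List Point) (p : Point) : State :=
  { σ with pos := p, walk := σ.walk ++ path, halted := true }

/-- The robot returns to the next higher fence by the path by which it came, and gets to `p`. -/
def goUp (σ : State) (p : Point) : State :=
  { σ with i := σ.i - 1, pos := p, walk := σ.walk ++ (σ.trail σ.i).reverse }

/-- One iteration of the procedure: the first case that applies is executed.  If the actions of
this case cannot be completed, there is no next state. -/
inductive Step (S : Scene) (τ : ℝ) (k M : ℕ) : State → State → Prop
  | case1 (σ : State) (path : List Point) (p : Point) :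
      σ.halted = false → Case1 k σ →
      GoBackDown S τ σ.post σ.branch σ.i (σ.M σ.i) (σ.M (σ.i + 1)) σ.pos path p →
      Step S τ k M σ (σ.goDown path p)
  | case2 (σ : State) (path : List Point) (p : Point) :
      σ.halted = false → ¬ Case1 k σ → Case2 k σ →
      DownEdge S τ σ.pos path p → p.1 ≠ S.n →
      Step S τ k M σ (σ.addPost (σ.i + 1) path p path)
  | case2Wall (σ : State) (path : List Point) (p : Point) :
      σ.halted = false → ¬ Case1 k σ → Case2 k σ →
      DownEdge S τ σ.pos path p → p.1 = S.n →
      Step S τ k M σ (σ.hitWall path p)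
  | case3 (σ : State) (path : List Point) (p : Point) :
      σ.halted = false → ¬ Case1 k σ → ¬ Case2 k σ → Case3 M σ →
      UpEdge S τ σ.pos path p → p.1 ≠ S.n →
      Step S τ k M σ (σ.addPost σ.i path p (σ.trail σ.i ++ path))
  | case3Wall (σ : State) (path : List Point) (p : Point) :
      σ.halted = false → ¬ Case1 k σ → ¬ Case2 k σ → Case3 M σ →
      UpEdge S τ σ.pos path p → p.1 = S.n →
      Step S τ k M σ (σ.hitWall path p)
  | case4 (σ : State) (path : List Point) (p : Point) :
      σ.halted = false → ¬ Case1 k σ → ¬ Case2 k σ → ¬ Case3 M σ → Case4 k M σ →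
      GoDown S τ σ.post σ.branch σ.i (σ.M σ.i) (σ.M (σ.i + 1)) σ.pos path p →
      Step S τ k M σ (σ.goDown path p)
  | case5 (σ : State) :
      σ.halted = false → ¬ Case1 k σ → ¬ Case2 k σ → ¬ Case3 M σ → ¬ Case4 k M σ →
      Case5 k M σ →
      Step S τ k M σ { σ with halted := true }
  | case6 (σ : State) (p : Point) :
      σ.halted = false → ¬ Case1 k σ → ¬ Case2 k σ → ¬ Case3 M σ → ¬ Case4 k M σ →
      ¬ Case5 k M σ → 1 < σ.i → (σ.trail σ.i).head? = some p →
      Step S τ k M σ (σ.goUp p)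

/-- `σ` is reached at some time in some run of the procedure with initial post `P₀`. -/
def Reachable (S : Scene) (τ : ℝ) (k M : ℕ) (P₀ : Point) (σ : State) : Prop :=
  Relation.ReflTransGen (Step S τ k M) (init P₀) σ

end State

end Nav

/-! The posts found so far form a staircase: no fence has more posts than the fence above it, and
every post was reached by the edge that the tree prescribes (`FoundTree`). An up-edge gains height
`τ` and a down-edge loses it, so the `m`-th post of the `i`-th fence has height `P₀.2 + (m - i) *
τ`. By the parent rule, abscissas never decrease along a fence or from a fence to the next lower one
(`le_right`, `le_down`).

`GoDown` works because a fence is a barrier. A robot that slides left cannot pass the left edge of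
an obstacle at a height that this edge covers, as it would slide on an overlapping obstacle
(`left_le_of_blocksDown`), and the lower halves of the posts of a fence are stacked without gaps. So
the robot stays to the right of `F_i` and arrives above the branch to its target (`mem_aboveTrace`).
This branch is `x`-monotone and therefore separates what is above it from what is below it
(`above_of_segment_disjoint`); moving right and down, the robot meets the branch or the post. In
`GoBackDown` the barrier consists of the upper halves of the posts with one fixed number `m` on
`F_1, …, F_i`. All motions are finite because left edges have integral abscissas and widths and
heights are at least `1`.

The invariant `State.Inv` yields the conditions of both subroutines, and shows that each new edge
obeys the parent rule. For termination (`fuel`), the robot goes down to a fence only to try at once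
to extend it, returning lowers the index of the current fence, and finding a post lowers the number
of missing posts. At a halt away from the wall the lowest fence is complete, hence by the staircase
property every fence is. The tree is unique since the end of a `τ`-path before the wall is
determined by its start (`TauPath.end_unique`), although a tie between corners may leave a choice of
path. -/

namespace Nav

/-! ### Segments -/

lemma mem_segment_horizontal {x₁ x₂ y : ℝ} (h : x₁ ≤ x₂) {z : Point} :
    z ∈ segment ℝ ((x₁, y) : Point) (x₂, y) ↔ z.2 = y ∧ x₁ ≤ z.1 ∧ z.1 ≤ x₂ := by
  rw [← Prod.image_mk_segment_left, segment_eq_Icc h]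
  constructor
  · rintro ⟨t, ht, rfl⟩
    exact ⟨rfl, ht.1, ht.2⟩
  · rintro ⟨rfl, h1, h2⟩
    exact ⟨z.1, ⟨h1, h2⟩, rfl⟩

lemma mem_segment_vertical {x y₁ y₂ : ℝ} (h : y₁ ≤ y₂) {z : Point} :
    z ∈ segment ℝ ((x, y₁) : Point) (x, y₂) ↔ z.1 = x ∧ y₁ ≤ z.2 ∧ z.2 ≤ y₂ := by
  rw [← Prod.image_mk_segment_right, segment_eq_Icc h]
  constructor
  · rintro ⟨t, ht, rfl⟩
    exact ⟨rfl, ht.1, ht.2⟩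
  · rintro ⟨rfl, h1, h2⟩
    exact ⟨z.2, ⟨h1, h2⟩, rfl⟩

lemma fst_mem_of_mem_segment {p q z : Point} (h : p.1 ≤ q.1) (hz : z ∈ segment ℝ p q) :
    p.1 ≤ z.1 ∧ z.1 ≤ q.1 := by
  have := Prod.segment_subset _ _ hz
  rw [Set.mem_prod, segment_eq_Icc h] at this
  exact this.1

lemma snd_eq_of_mem_segment {p q z : Point} (h : p.2 = q.2) (hz : z ∈ segment ℝ p q) :
    z.2 = p.2 := by
  have := Prod.segment_subset _ _ hz
  rw [Set.mem_prod, ← h, segment_same] at this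
  exact this.2

/-! ### Obstacles and free points -/

lemma Obstacle.left_lt_right (R : Obstacle) : R.left < R.right := by
  have := R.one_le_width
  omega

lemma Obstacle.bottom_lt_top (R : Obstacle) : R.bottom < R.top := by
  have := R.one_le_height
  linarith

/-- Two obstacles that overlap are equal. -/
lemma Scene.eq_of_overlap (S : Scene) {R R' : Obstacle} (hR : R ∈ S.obstacles)
    (hR' : R' ∈ S.obstacles) (h1 : R.left < R'.right) (h2 : R'.left < R.right)
    (h3 : R.bottom < R'.top) (h4 : R'.bottom < R.top) : R = R' := by
  by_contra hne
  have hd := S.nonoverlapping hR hR' hne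
  obtain ⟨x, hx1, hx2⟩ : ∃ x : ℝ, max (R.left : ℝ) R'.left < x ∧ x < min (R.right : ℝ) R'.right := by
    apply exists_between
    rw [max_lt_iff, lt_min_iff, lt_min_iff]
    have a := R.left_lt_right
    have b := R'.left_lt_right
    norm_cast
  obtain ⟨y, hy1, hy2⟩ : ∃ y : ℝ, max R.bottom R'.bottom < y ∧ y < min R.top R'.top := by
    apply exists_between
    rw [max_lt_iff, lt_min_iff, lt_min_iff]
    exact ⟨⟨R.bottom_lt_top, h3⟩, h4, R'.bottom_lt_top⟩
  rw [max_lt_iff] at hx1 hy1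
  rw [lt_min_iff] at hx2 hy2
  exact Set.disjoint_left.1 hd (show ((x, y) : Point) ∈ R.interior from ⟨hx1.1, hx2.1, hy1.1, hy2.1⟩)
    ⟨hx1.2, hx2.2, hy1.2, hy2.2⟩

lemma Obstacle.BlocksRight.unique {S : Scene} {R R' : Obstacle} {p : Point}
    (hR : R ∈ S.obstacles) (hR' : R' ∈ S.obstacles) (h : R.BlocksRight p) (h' : R'.BlocksRight p) :
    R = R' := by
  have e : R.left = R'.left := by exact_mod_cast h.1.symm.trans h'.1
  have a := R.left_lt_right
  have b := R'.left_lt_right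
  exact S.eq_of_overlap hR hR' (by omega) (by omega) (h.2.1.trans h'.2.2) (h'.2.1.trans h.2.2)

/-- The robot can be at the point `p`. -/
def Scene.FreeAt (S : Scene) (p : Point) : Prop :=
  p.1 ≤ S.n ∧ ∀ R ∈ S.obstacles, p ∉ R.interior

/-- A point of an obstacle that is not in its interior is free. -/
lemma Scene.freeAt_of_boundary (S : Scene) {p : Point} (hn : p.1 ≤ S.n) {R : Obstacle}
    (hR : R ∈ S.obstacles) (h1 : (R.left : ℝ) ≤ p.1) (h2 : p.1 ≤ R.right) (h3 : R.bottom ≤ p.2)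
    (h4 : p.2 ≤ R.top) (h : p ∉ R.interior) : S.FreeAt p := by
  refine ⟨hn, fun R' hR' hp => h ?_⟩
  obtain ⟨a, b, c, d⟩ := hp
  have e1 : (R.left : ℝ) < R'.right := h1.trans_lt b
  have e2 : (R'.left : ℝ) < R.right := a.trans_le h2
  have := S.eq_of_overlap hR hR' (by exact_mod_cast e1) (by exact_mod_cast e2)
    (h3.trans_lt d) (c.trans_le h4)
  subst this
  exact ⟨a, b, c, d⟩

lemma Scene.freeAt_of_left (S : Scene) {p : Point} (hn : p.1 ≤ S.n) {R : Obstacle}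
    (hR : R ∈ S.obstacles) (h1 : p.1 = R.left) (h3 : R.bottom ≤ p.2)
    (h4 : p.2 ≤ R.top) : S.FreeAt p := by
  have : (R.left : ℝ) < R.right := by exact_mod_cast R.left_lt_right
  exact S.freeAt_of_boundary hn hR h1.ge (by linarith) h3 h4 fun h => by
    have := h.1
    linarith

lemma Scene.freeAt_of_right (S : Scene) {p : Point} (hn : p.1 ≤ S.n) {R : Obstacle}
    (hR : R ∈ S.obstacles) (h1 : p.1 = R.right) (h3 : R.bottom ≤ p.2)
    (h4 : p.2 ≤ R.top) : S.FreeAt p := by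
  have : (R.left : ℝ) < R.right := by exact_mod_cast R.left_lt_right
  exact S.freeAt_of_boundary hn hR (by linarith) h1.le h3 h4 fun h => by
    have := h.2.1
    linarith

lemma Scene.freeAt_of_top_or_bottom (S : Scene) {p : Point} (hn : p.1 ≤ S.n) {R : Obstacle}
    (hR : R ∈ S.obstacles) (h1 : (R.left : ℝ) ≤ p.1) (h2 : p.1 ≤ R.right)
    (h : p.2 = R.top ∨ p.2 = R.bottom) : S.FreeAt p := by
  have := R.bottom_lt_top
  refine S.freeAt_of_boundary hn hR h1 h2 ?_ ?_ fun hp => ?_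
  · rcases h with h | h <;> linarith
  · rcases h with h | h <;> linarith
  · have a := hp.2.2.1
    have b := hp.2.2.2
    rcases h with h | h <;> linarith

lemma Scene.IsPost.freeAt {S : Scene} {τ : ℝ} {p : Point} (h : S.IsPost τ p)
    (hn : p.1 ≤ S.n) {y : ℝ} (h1 : p.2 - τ ≤ y) (h2 : y ≤ p.2 + τ) : S.FreeAt (p.1, y) := by
  obtain ⟨R, hR, a, b, c⟩ := h
  exact S.freeAt_of_left (p := (p.1, y)) hn hR a (b.trans h1) (h2.trans c)

/-- Move to the right until an obstacle or the line `x = B` is hit. -/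
lemma Scene.exists_right (S : Scene) {p : Point} (hp : S.FreeAt p) {B : ℝ} (hB : p.1 ≤ B)
    (hn : B ≤ S.n) : ∃ q : Point, q.2 = p.2 ∧ p.1 ≤ q.1 ∧ q.1 ≤ B ∧ S.Free (segment ℝ p q) ∧
      (q.1 = B ∨ ∃ R ∈ S.obstacles, R.BlocksRight q) := by
  obtain ⟨x, y⟩ := p
  have key : ∀ x', x ≤ x' → x' ≤ B → (∀ R ∈ S.obstacles, x ≤ (R.left : ℝ) → R.bottom < y →
      y < R.top → x' ≤ R.left) → S.Free (segment ℝ ((x, y) : Point) (x', y)) := by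
    intro x' h1 h2 h z hz
    rw [mem_segment_horizontal h1] at hz
    refine ⟨by linarith, fun R hR hzR => ?_⟩
    obtain ⟨a, b, c, d⟩ := hzR
    rw [hz.1] at c d
    rcases le_or_gt x R.left with hx | hx
    · have := h R hR hx c d
      linarith
    · exact hp.2 R hR ⟨hx, by show x < _; linarith, c, d⟩
  by_cases hne : ∃ c : ℤ, ∃ R ∈ S.obstacles, R.left = c ∧ x ≤ (c : ℝ) ∧ (c : ℝ) < B ∧
      R.bottom < y ∧ y < R.top
  -- There may be infinitely many obstacles; a first left edge in the way exists because left edges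
  -- have integral abscissas.
  · obtain ⟨c, ⟨R, hR, rfl, h1, h2, h3, h4⟩, hmin⟩ := Int.exists_least_of_bdd
      (P := fun c : ℤ => ∃ R ∈ S.obstacles, R.left = c ∧ x ≤ (c : ℝ) ∧ (c : ℝ) < B ∧
      R.bottom < y ∧ y < R.top) ⟨⌊x⌋, fun c hc => by
        obtain ⟨R, hR, rfl, h1, -⟩ := hc
        exact_mod_cast (Int.floor_le x).trans h1⟩ hne
    refine ⟨(R.left, y), rfl, h1, h2.le, key _ h1 h2.le ?_, Or.inr ⟨R, hR, rfl, h3, h4⟩⟩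
    intro R' hR' a b c
    by_cases hlt : (R'.left : ℝ) < B
    · exact_mod_cast hmin R'.left ⟨R', hR', rfl, a, hlt, b, c⟩
    · linarith
  · push Not at hne
    refine ⟨(B, y), rfl, hB, le_rfl, key _ hB le_rfl ?_, Or.inl rfl⟩
    intro R hR a b c
    by_contra! hlt
    exact absurd (hne _ R hR rfl a hlt b) (by simpa using c)

/-! ### Existence and uniqueness of `τ`-paths -/

lemma Obstacle.exists_nearestCorner (R : Obstacle) (y : ℝ) : ∃ c, R.NearestCorner y c := by
  rcases le_total (R.top - y) (y - R.bottom) with h | h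
  · exact ⟨_, Or.inl ⟨rfl, h⟩⟩
  · exact ⟨_, Or.inr ⟨rfl, h⟩⟩

/-- `N` bounds the distance to the wall. Going around an obstacle gains at least `1`, its width, and
a move ahead ends at the wall or at an obstacle. -/
lemma Scene.exists_tauPath (S : Scene) {τ : ℝ} (N : ℕ) : ∀ p : Point, S.FreeAt p → S.n - p.1 ≤ N →
    ∃ l e, TauPath S τ p l e := by
  induction N with
  | zero =>
    intro p hp hN
    have := hp.1
    exact ⟨_, _, TauPath.wall p (by push_cast at hN; linarith)⟩
  | succ N ih =>
    have blocked : ∀ p : Point, S.FreeAt p → S.n - p.1 ≤ (N + 1 : ℕ) →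
        (p.1 = S.n ∨ ∃ R ∈ S.obstacles, R.BlocksRight p) → ∃ l e, TauPath S τ p l e := by
      intro p hp hN h
      rcases hp.1.eq_or_lt with hn | hn
      · exact ⟨_, _, TauPath.wall p hn⟩
      by_cases hpost : S.IsPost τ p
      · exact ⟨_, _, TauPath.post p hn hpost⟩
      obtain h | ⟨R, hR, hb⟩ := h
      · exact absurd h hn.ne
      obtain ⟨c, hc⟩ := R.exists_nearestCorner p.2
      have hcτ : |c - p.2| < τ := by
        by_contra! hle
        -- If the nearest corner is at least `τ` away, then so is the other one, and the point is
        -- the center of a post.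
        apply hpost
        refine ⟨R, hR, hb.1, ?_⟩
        obtain ⟨h1, h2, h3⟩ := hb
        rcases hc with ⟨rfl, h⟩ | ⟨rfl, h⟩
        · rw [abs_of_pos (by linarith)] at hle
          constructor <;> linarith
        · rw [abs_of_neg (by linarith)] at hle
          constructor <;> linarith
      have hw : (R.left : ℝ) + 1 ≤ R.right := by exact_mod_cast R.one_le_width
      rcases lt_or_ge (R.right : ℝ) S.n with hr | hr
      · obtain ⟨l, e, hl⟩ := ih (R.right, p.2)
          (S.freeAt_of_right hr.le hR rfl hb.2.1.le hb.2.2.le) (by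
            have := hb.1
            push_cast at hN ⊢
            linarith)
        exact ⟨_, _, TauPath.around p R c l e hn hpost hR hb hc hcτ hr hl⟩
      · exact ⟨_, _, TauPath.aroundWall p R c hn hpost hR hb hc hcτ hr⟩
    intro p hp hN
    by_cases h : p.1 = S.n ∨ ∃ R ∈ S.obstacles, R.BlocksRight p
    · exact blocked p hp hN h
    push Not at h
    have hn := lt_of_le_of_ne hp.1 h.1
    by_cases hpost : S.IsPost τ p
    · exact ⟨_, _, TauPath.post p hn hpost⟩
    obtain ⟨q, hq1, hq2, hq3, hfree, hq⟩ := S.exists_right hp hn.le le_rfl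
    obtain ⟨l, e, hl⟩ := blocked q (hfree q (right_mem_segment ℝ p q)) (by linarith) hq
    refine ⟨_, _, TauPath.ahead p q l e hn hpost h.2 (lt_of_le_of_ne hq2 ?_) hq1 hfree hq hl⟩
    intro heq
    have : q = p := Prod.ext heq.symm hq1
    subst this
    rcases hq with hq | ⟨R, hR, hb⟩
    · exact h.1 hq
    · exact h.2 R hR hb

namespace TauPath

variable {S : Scene} {τ : ℝ} {p e : Point} {l : List Point}

lemma head?_eq (h : TauPath S τ p l e) : l.head? = some p := by
  cases h <;> rfl

lemma getLast?_eq (h : TauPath S τ p l e) : l.getLast? = some e := by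
  induction h with
  | wall | post => rfl
  | ahead _ _ l _ _ _ _ _ _ _ _ hl ih =>
    simp [List.getLast?_cons, ih]
  | around _ _ _ l _ _ _ _ _ _ _ _ hl ih =>
    simp [List.getLast?_cons, ih]
  | aroundWall => rfl

/-- Every detour returns to the height at which it began, so a post that is reached is centered at
the height of the start. -/
lemma wall_or_post (h : TauPath S τ p l e) :
    e.1 = S.n ∨ (e.1 < S.n ∧ S.IsPost τ e ∧ e.2 = p.2) := by
  induction h with
  | wall p h => exact Or.inl h
  | post p h h' => exact Or.inr ⟨h, h', rfl⟩
  | ahead p q l e _ _ _ _ h _ _ hl ih => rwa [h] at ih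
  | around _ _ _ l _ _ _ _ _ _ _ _ hl ih => exact ih
  | aroundWall => exact Or.inl rfl

lemma fst_le (h : TauPath S τ p l e) (he : e.1 < S.n) : p.1 ≤ e.1 := by
  induction h with
  | wall p h => rfl
  | post p h h' => rfl
  | ahead p q l e _ _ _ hpq h _ _ hl ih => exact hpq.le.trans (ih he)
  | around p R _ l _ _ _ _ hb _ _ _ hl ih =>
    have : (R.left : ℝ) < R.right := by exact_mod_cast R.left_lt_right
    exact hb.1.le.trans (this.le.trans (ih he))
  | aroundWall => exact absurd he (lt_irrefl _)

lemma mem_bounds (h : TauPath S τ p l e) (he : e.1 < S.n) : ∀ z ∈ l, p.1 ≤ z.1 ∧ z.1 ≤ e.1 := by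
  induction h with
  | wall p h => simp
  | post p h h' => simp
  | ahead p q l e _ _ _ hpq h _ _ hl ih =>
    have := hl.fst_le he
    intro z hz
    rcases List.mem_cons.1 hz with rfl | hz
    · exact ⟨le_rfl, by linarith⟩
    · have := ih he z hz
      exact ⟨by linarith, this.2⟩
  | around p R _ l _ _ _ _ hb _ _ _ hl ih =>
    have hle : (R.right : ℝ) ≤ _ := hl.fst_le he
    have hlt : (R.left : ℝ) < R.right := by exact_mod_cast R.left_lt_right
    have := hb.1
    intro z hz
    simp only [List.mem_cons] at hz
    rcases hz with rfl | rfl | rfl | hz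
    · exact ⟨le_rfl, by linarith⟩
    · exact ⟨this.le, by linarith⟩
    · exact ⟨by linarith, by linarith⟩
    · have := ih he z hz
      simp only at this
      exact ⟨by linarith, this.2⟩
  | aroundWall => exact absurd he (lt_irrefl _)

/-- The `x`-coordinate never decreases along a `τ`-path. -/
lemma pairwise (h : TauPath S τ p l e) (he : e.1 < S.n) : l.Pairwise fun u v => u.1 ≤ v.1 := by
  induction h with
  | wall p h => simp
  | post p h h' => simp
  | ahead p q l e _ _ _ hpq h _ _ hl ih =>
    refine List.pairwise_cons.2 ⟨fun z hz => ?_, ih he⟩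
    have := hl.mem_bounds he z hz
    linarith
  | around p R _ l _ _ _ _ hb _ _ _ hl ih =>
    have hlt : (R.left : ℝ) < R.right := by exact_mod_cast R.left_lt_right
    have := hb.1
    have h1 := hl.mem_bounds he
    simp only at h1
    simp only [List.pairwise_cons, List.mem_cons, forall_eq_or_imp]
    refine ⟨⟨by linarith, by linarith, fun z hz => ?_⟩, ⟨by linarith, fun z hz => ?_⟩,
      fun z hz => ?_, ih he⟩ <;> have := h1 z hz <;> linarith
  | aroundWall => exact absurd he (lt_irrefl _)

/-- Just beyond a blocked point lies the interior of the blocking obstacle. Used in both directions,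
this shows that two moves ahead from one point stop at the same point. -/
lemma not_past_block {p q q' : Point} (hpq : p.1 < q.1) (h2 : q.2 = p.2) (h2' : q'.2 = p.2)
    (hfree : S.Free (segment ℝ p q')) (hq : q.1 = S.n ∨ ∃ R ∈ S.obstacles, R.BlocksRight q) :
    q'.1 ≤ q.1 := by
  by_contra! hlt
  obtain hq | ⟨R, hR, hb1, hb2, hb3⟩ := hq
  · have := (hfree q' (right_mem_segment ℝ p q')).1
    linarith
  · have hlr : (R.left : ℝ) < R.right := by exact_mod_cast R.left_lt_right
    obtain ⟨x, hx1, hx2⟩ := exists_between (lt_min hlt (hb1.trans_lt hlr))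
    rw [lt_min_iff] at hx2
    obtain ⟨p1, p2⟩ := p
    obtain ⟨q1, q2⟩ := q'
    simp only at h2 h2' hpq hlt hx2 hfree
    subst h2'
    refine (hfree (x, q2) ?_).2 R hR ⟨by show _ < x; linarith, hx2.2, ?_, ?_⟩
    · rw [mem_segment_horizontal (by linarith)]
      exact ⟨rfl, by show p1 ≤ x; linarith, hx2.1.le⟩
    · show _ < q2; linarith
    · show q2 < _; linarith

/-- The end of a `τ`-path that does not reach the wall is determined by its start. -/
lemma end_unique (h : TauPath S τ p l e) : ∀ {l' : List Point} {e' : Point}, TauPath S τ p l' e' →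
    e.1 < S.n → e'.1 < S.n → e = e' := by
  induction h with
  | wall p h => intro l' e' _ he; exact absurd h he.ne
  | post p h h' =>
    intro l' e' hl' _ he'
    cases hl' <;> first | rfl | contradiction
  | ahead p q l e h1 h2 h3 h4 h5 h6 h7 hl ih =>
    intro l' e' hl' he he'
    cases hl' with
    | wall => exact absurd he' (by linarith)
    | post => contradiction
    | ahead _ q' l' _ g1 g2 g3 g4 g5 g6 g7 gl =>
      have a := not_past_block h4 h5 g5 g6 h7
      have b := not_past_block g4 g5 h5 h6 g7
      have : q = q' := Prod.ext (by linarith) (by rw [h5, g5])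
      subst this
      exact ih gl he he'
    | around _ R c l _ g1 g2 g3 g4 => exact absurd g4 (h3 R g3)
    | aroundWall _ R c  g1 g2 g3 g4 => exact absurd g4 (h3 R g3)
  | around p R c l e h1 h2 h3 h4 h5 h6 h7 hl ih =>
    intro l' e' hl' he he'
    cases hl' with
    | wall => exact absurd he' (by linarith)
    | post => contradiction
    | ahead _ q' l' _ g1 g2 g3 g4 g5 g6 g7 gl => exact absurd h4 (g3 R h3)
    | around _ R' c l _ g1 g2 g3 g4 g5 g6 g7 gl =>
      -- In a tie the two paths may use different corners, but they rejoin at the right edge of the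
      -- obstacle.
      have := h4.unique h3 g3 g4
      subst this
      exact ih gl he he'
    | aroundWall => exact absurd he' (lt_irrefl _)
  | aroundWall => intro l' e' _ he; exact absurd he (lt_irrefl _)

end TauPath

/-! ### The horizontal pieces of a `τ`-path -/

lemma pair_infix_cons {α : Type*} {u v a : α} {l : List α} (h : [u, v] <:+: a :: l) :
    (u = a ∧ l.head? = some v) ∨ [u, v] <:+: l := by
  rcases List.infix_cons_iff.1 h with h | h
  · left
    obtain ⟨t, ht⟩ := h
    simp only [List.cons_append, List.nil_append, List.cons.injEq] at ht
    exact ⟨ht.1, by simp [← ht.2]⟩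
  · exact Or.inr h

/-- The piece from `u` to `v` of a `τ`-path at height `y`: either it is at this height, or it
goes along the top or the bottom of an obstacle. -/
def Scene.HorizontalPiece (S : Scene) (τ y : ℝ) (u v : Point) : Prop :=
  S.Free (segment ℝ u v) ∧ u.2 = v.2 ∧ (u.2 = y ∨ ∃ R ∈ S.obstacles, u.1 = R.left ∧
    v.1 = R.right ∧ R.bottom < y ∧ y < R.top ∧ |u.2 - y| < τ ∧ (u.2 = R.top ∨ u.2 = R.bottom))

/-- The pieces that advance are the moves ahead and the passages along the top or bottom of an
obstacle; `hlt` rules out the two vertical pieces of a detour. -/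
lemma TauPath.horizontalPiece {S : Scene} {τ : ℝ} {p e : Point} {l : List Point}
    (h : TauPath S τ p l e) (he : e.1 < S.n) {u v : Point} (huv : [u, v] <:+: l)
    (hlt : u.1 < v.1) : p.1 ≤ u.1 ∧ S.HorizontalPiece τ p.2 u v := by
  induction h with
  | wall p h =>
    have := huv.length_le
    simp at this
  | post p h h' =>
    have := huv.length_le
    simp at this
  | ahead p q l e _ _ _ hpq h hfree _ hl ih =>
    rcases pair_infix_cons huv with ⟨rfl, hv⟩ | huv
    · rw [hl.head?_eq] at hv
      cases hv
      exact ⟨le_rfl, hfree, h.symm, Or.inl rfl⟩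
    · rw [h] at ih
      have := ih he huv
      exact ⟨hpq.le.trans this.1, this.2⟩
  | around p R c l e _ _ hR hb hc hcτ hn hl ih =>
    have hlr : (R.left : ℝ) < R.right := by exact_mod_cast R.left_lt_right
    have hb1 := hb.1
    rcases pair_infix_cons huv with ⟨rfl, hv⟩ | huv
    · simp only [List.head?_cons, Option.some.injEq] at hv
      subst hv
      exact absurd hlt (by simp [hb.1])
    rcases pair_infix_cons huv with ⟨rfl, hv⟩ | huv
    · simp only [List.head?_cons, Option.some.injEq] at hv
      subst hv
      have hc' : c = R.top ∨ c = R.bottom := hc.imp And.left And.left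
      refine ⟨hb.1.le, ?_, rfl, Or.inr ⟨R, hR, rfl, rfl, hb.2.1, hb.2.2, hcτ, hc'⟩⟩
      intro z hz
      rw [mem_segment_horizontal hlr.le] at hz
      exact S.freeAt_of_top_or_bottom (by linarith) hR hz.2.1 hz.2.2 (by rwa [hz.1])
    rcases pair_infix_cons huv with ⟨rfl, hv⟩ | huv
    · rw [hl.head?_eq] at hv
      cases hv
      exact absurd hlt (lt_irrefl _)
    · have := ih he huv
      simp only at this
      exact ⟨by linarith, this.2⟩
  | aroundWall => exact absurd he (lt_irrefl _)

/-! ### Traces -/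

lemma trace_mono {l l' : List Point} (h : l <:+: l') : trace l ⊆ trace l' := by
  rintro z ⟨u, v, huv, hz⟩
  exact ⟨u, v, huv.trans h, hz⟩

/-- A path with a single point has no piece, hence an empty trace. This is why the root, whose
branch is `[P₀]`, is excluded wherever a post has to lie on the trace of its branch. -/
lemma trace_of_length_le {l : List Point} (h : l.length ≤ 1) : trace l = ∅ := by
  rw [Set.eq_empty_iff_forall_notMem]
  rintro z ⟨u, v, huv, -⟩
  have := huv.length_le
  simp at this
  omega

lemma trace_cons_cons (u v : Point) (l : List Point) :
    trace (u :: v :: l) = segment ℝ u v ∪ trace (v :: l) := by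
  ext z
  constructor
  · rintro ⟨a, b, hab, hz⟩
    rcases pair_infix_cons hab with ⟨rfl, hb⟩ | hab
    · simp only [List.head?_cons, Option.some.injEq] at hb
      subst hb
      exact Or.inl hz
    · exact Or.inr ⟨a, b, hab, hz⟩
  · rintro (hz | hz)
    · exact ⟨u, v, ⟨[], l, rfl⟩, hz⟩
    · exact trace_mono (List.infix_cons List.infix_rfl) hz

lemma mem_trace_of_mem {l : List Point} (h : 2 ≤ l.length) {z : Point} (hz : z ∈ l) :
    z ∈ trace l := by
  induction l with
  | nil => simp at h
  | cons u l ih =>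
    match l, ih, h, hz with
    | [v], _, _, hz =>
      rw [trace_cons_cons]
      left
      simp only [List.mem_cons, List.not_mem_nil, or_false] at hz
      rcases hz with rfl | rfl
      · exact left_mem_segment ℝ _ _
      · exact right_mem_segment ℝ _ _
    | v :: w :: l, ih, _, hz =>
      rw [trace_cons_cons]
      rcases List.mem_cons.1 hz with rfl | hz
      · exact Or.inl (left_mem_segment ℝ _ _)
      · exact Or.inr (ih (by simp) hz)

lemma isCompact_trace (l : List Point) : IsCompact (trace l) := by
  induction l with
  | nil =>
    rw [trace_of_length_le (by simp)]
    exact isCompact_empty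
  | cons u l ih =>
    match l, ih with
    | [], _ =>
      rw [trace_of_length_le (by simp)]
      exact isCompact_empty
    | v :: l, ih =>
      rw [trace_cons_cons]
      refine IsCompact.union ?_ ih
      rw [segment_eq_image]
      exact isCompact_Icc.image (by fun_prop)

lemma isPreconnected_trace (l : List Point) : IsPreconnected (trace l) := by
  induction l with
  | nil =>
    rw [trace_of_length_le (by simp)]
    exact isPreconnected_empty
  | cons u l ih =>
    match l, ih with
    | [], _ =>
      rw [trace_of_length_le (by simp)]
      exact isPreconnected_empty
    | [v], _ =>
      rw [trace_cons_cons, trace_of_length_le (l := [v]) (by simp), Set.union_empty]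
      exact (convex_segment u v).isPreconnected
    | v :: w :: l, ih =>
      rw [trace_cons_cons]
      refine IsPreconnected.union v (right_mem_segment ℝ u v) ?_
        (convex_segment u v).isPreconnected ih
      exact mem_trace_of_mem (by simp) (by simp)

lemma exists_mem_trace_fst {l : List Point} {s t : Point} (hs : s ∈ trace l) (ht : t ∈ trace l)
    {x : ℝ} (h1 : s.1 ≤ x) (h2 : x ≤ t.1) : ∃ z ∈ trace l, z.1 = x := by
  obtain ⟨z, hz, hzx⟩ := (isPreconnected_trace l).intermediate_value hs ht
    continuous_fst.continuousOn ⟨h1, h2⟩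
  exact ⟨z, hz, hzx⟩

/-- The `x`-coordinate never decreases along the path. -/
def XMonotone (l : List Point) : Prop := l.Pairwise fun u v => u.1 ≤ v.1

/-- The intersection of an `x`-monotone path with a vertical line is convex. -/
lemma mem_trace_of_between {l : List Point} (hl : XMonotone l) {s t z : Point} (hs : s ∈ trace l)
    (ht : t ∈ trace l) (hsz : s.1 = z.1) (htz : t.1 = z.1) (h1 : s.2 ≤ z.2) (h2 : z.2 ≤ t.2) :
    z ∈ trace l := by
  have conv : ∀ {A : Set Point}, Convex ℝ A → ∀ {s t z : Point}, s ∈ A → t ∈ A → s.1 = z.1 →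
      t.1 = z.1 → s.2 ≤ z.2 → z.2 ≤ t.2 → z ∈ A := by
    intro A hA s t z hs ht hsz htz h1 h2
    apply hA.segment_subset hs ht
    obtain ⟨s1, s2⟩ := s
    obtain ⟨t1, t2⟩ := t
    simp only at hsz htz h1 h2
    subst hsz htz
    rw [mem_segment_vertical (h1.trans h2)]
    exact ⟨rfl, h1, h2⟩
  induction l generalizing s t with
  | nil => simp [trace_of_length_le] at hs
  | cons u l ih =>
    match l, ih with
    | [], _ => simp [trace_of_length_le] at hs
    | v :: l, ih =>
      have hl' : XMonotone (v :: l) := (List.pairwise_cons.1 hl).2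
      have huv : u.1 ≤ v.1 := (List.pairwise_cons.1 hl).1 v (by simp)
      -- If one of the two points is on the first piece and the other on the rest, then `v`, where
      -- these meet, lies on the same vertical line, and one of the two parts contains `z`.
      have two : ∀ {y : Point}, y ∈ trace (v :: l) → v ∈ trace (v :: l) ∧ v.1 ≤ y.1 := by
        rintro y ⟨a, b, hab, hy⟩
        have hlen := hab.length_le
        refine ⟨mem_trace_of_mem hlen (by simp), ?_⟩
        have hge : ∀ c ∈ v :: l, v.1 ≤ c.1 := by
          intro c hc
          rcases List.mem_cons.1 hc with rfl | hc
          · exact le_rfl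
          · exact (List.pairwise_cons.1 hl').1 c hc
        have ha := hge a (hab.subset (by simp))
        have hb := hge b (hab.subset (by simp))
        rcases le_total a.1 b.1 with h | h
        · exact ha.trans (fst_mem_of_mem_segment h hy).1
        · rw [segment_symm] at hy
          exact hb.trans (fst_mem_of_mem_segment h hy).1
      rw [trace_cons_cons] at hs ht ⊢
      rcases hs with hs | hs <;> rcases ht with ht | ht
      · exact Or.inl (conv (convex_segment u v) hs ht hsz htz h1 h2)
      · obtain ⟨hv, hvt⟩ := two ht
        have := (fst_mem_of_mem_segment huv hs).2
        have hvz : v.1 = z.1 := by linarith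
        rcases le_total v.2 z.2 with h | h
        · exact Or.inr (ih hl' hv ht hvz htz h h2)
        · exact Or.inl (conv (convex_segment u v) hs (right_mem_segment ℝ u v) hsz hvz h1 h)
      · obtain ⟨hv, hvt⟩ := two hs
        have := (fst_mem_of_mem_segment huv ht).2
        have hvz : v.1 = z.1 := by linarith
        rcases le_total v.2 z.2 with h | h
        · exact Or.inl (conv (convex_segment u v) (right_mem_segment ℝ u v) ht hvz htz h h2)
        · exact Or.inr (ih hl' hs hv hsz hvz h1 h)
      · exact Or.inr (ih hl' hs ht hsz htz h1 h2)

/-! ### Above and below a path -/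

/-- The points of the path, and those vertically above them. -/
def aboveTrace (l : List Point) : Set Point := {z | ∃ t ∈ trace l, t.1 = z.1 ∧ t.2 ≤ z.2}

/-- The points of the path, and those vertically below them. -/
def belowTrace (l : List Point) : Set Point := {z | ∃ t ∈ trace l, t.1 = z.1 ∧ z.2 ≤ t.2}

-- The sum of a compact set and a closed vertical ray is closed.
open scoped Pointwise in
lemma isClosed_aboveTrace (l : List Point) : IsClosed (aboveTrace l) := by
  have : aboveTrace l = trace l + {z : Point | z.1 = 0 ∧ 0 ≤ z.2} := by
    ext z
    rw [Set.mem_add]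
    constructor
    · rintro ⟨t, ht, h1, h2⟩
      exact ⟨t, ht, z - t, ⟨by simp [h1], by simpa using h2⟩, by simp⟩
    · rintro ⟨t, ht, d, ⟨h1, h2⟩, rfl⟩
      exact ⟨t, ht, by simp [h1], by simpa using h2⟩
  rw [this]
  refine IsClosed.add_left_of_isCompact ?_ (isCompact_trace l)
  exact (isClosed_eq continuous_fst continuous_const).inter
    (isClosed_le continuous_const continuous_snd)

open scoped Pointwise in
lemma isClosed_belowTrace (l : List Point) : IsClosed (belowTrace l) := by
  have : belowTrace l = trace l + {z : Point | z.1 = 0 ∧ z.2 ≤ 0} := by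
    ext z
    rw [Set.mem_add]
    constructor
    · rintro ⟨t, ht, h1, h2⟩
      exact ⟨t, ht, z - t, ⟨by simp [h1], by simpa using h2⟩, by simp⟩
    · rintro ⟨t, ht, d, ⟨h1, h2⟩, rfl⟩
      exact ⟨t, ht, by simp [h1], by simpa using h2⟩
  rw [this]
  refine IsClosed.add_left_of_isCompact ?_ (isCompact_trace l)
  exact (isClosed_eq continuous_fst continuous_const).inter
    (isClosed_le continuous_snd continuous_const)

lemma mem_trace_of_above_of_below {l : List Point} (hl : XMonotone l) {z : Point}
    (h1 : z ∈ aboveTrace l) (h2 : z ∈ belowTrace l) : z ∈ trace l := by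
  obtain ⟨s, hs, a, b⟩ := h1
  obtain ⟨t, ht, c, d⟩ := h2
  exact mem_trace_of_between hl hs ht a c b d

/-- A robot that moves straight to the right or vertically cannot get from the points above an
`x`-monotone path to the points below it without touching the path. -/
lemma above_of_segment_disjoint {l : List Point} (hl : XMonotone l) {p q P : Point}
    (hp : p ∈ aboveTrace l) (hpq : p.1 ≤ q.1) (hP : P ∈ trace l) (hqP : q.1 ≤ P.1)
    (hd : ∀ z ∈ segment ℝ p q, z ∉ trace l) : q ∈ aboveTrace l := by
  by_contra hq
  -- The abscissas on the segment lie between those of two points of the path, so the path meets the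
  -- vertical line through each point of the segment.
  have cover : segment ℝ p q ⊆ aboveTrace l ∪ belowTrace l := by
    intro z hz
    obtain ⟨t, ht, h1, -⟩ := hp
    have := fst_mem_of_mem_segment hpq hz
    obtain ⟨s, hs, hsz⟩ := exists_mem_trace_fst ht hP (x := z.1) (by linarith) (by linarith)
    rcases le_total s.2 z.2 with h | h
    · exact Or.inl ⟨s, hs, hsz, h⟩
    · exact Or.inr ⟨s, hs, hsz, h⟩
  obtain ⟨z, hz, h1, h2⟩ := isPreconnected_closed_iff.1 (convex_segment p q).isPreconnected _ _
    (isClosed_aboveTrace l) (isClosed_belowTrace l) cover ⟨p, left_mem_segment ℝ p q, hp⟩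
    ⟨q, right_mem_segment ℝ p q, (cover (right_mem_segment ℝ p q)).resolve_left hq⟩
  exact hd z hz (mem_trace_of_above_of_below hl h1 h2)

/-- A free point at or above the height of a `τ`-path is above it, unless it is beyond its end. -/
lemma TauPath.exists_le {S : Scene} {τ : ℝ} {p e : Point} {l : List Point}
    (h : TauPath S τ p l e) (he : e.1 < S.n) {a : Point} (ha : S.FreeAt a) (h1 : p.1 ≤ a.1)
    (h2 : a.1 ≤ e.1) (h3 : p.2 ≤ a.2) : ∃ t, (t ∈ l ∨ t ∈ trace l) ∧ t.1 = a.1 ∧ t.2 ≤ a.2 := by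
  induction h with
  | wall p h => exact ⟨p, Or.inl (by simp), le_antisymm h1 h2, h3⟩
  | post p h h' => exact ⟨p, Or.inl (by simp), le_antisymm h1 h2, h3⟩
  | ahead p q l e _ _ _ hpq h hfree _ hl ih =>
    rcases le_total a.1 q.1 with hq | hq
    · obtain ⟨l', rfl⟩ : ∃ l', l = q :: l' := by
        have := hl.head?_eq
        cases l with
        | nil => simp at this
        | cons b l => simp at this; exact ⟨l, by rw [this]⟩
      refine ⟨(a.1, p.2), Or.inr ?_, rfl, h3⟩
      rw [trace_cons_cons]
      left
      obtain ⟨p1, p2⟩ := p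
      obtain ⟨q1, q2⟩ := q
      simp only at h
      subst h
      exact (mem_segment_horizontal hpq.le).2 ⟨rfl, h1, hq⟩
    · obtain ⟨t, ht, h⟩ := ih he hq h2 (by linarith)
      exact ⟨t, ht.imp (List.mem_cons_of_mem _)
        fun ht => trace_mono (List.infix_cons List.infix_rfl) ht, h⟩
  | around p R c l e _ _ hR hb hc hcτ hn hl ih =>
    have hlr : (R.left : ℝ) < R.right := by exact_mod_cast R.left_lt_right
    obtain ⟨hb1, hb2, hb3⟩ := hb
    rcases h1.eq_or_lt with h1 | h1
    · exact ⟨p, Or.inl (by simp), h1, h3⟩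
    rcases lt_or_ge a.1 R.right with hr | hr
    · refine ⟨(a.1, c), Or.inr ?_, rfl, ?_⟩
      · refine ⟨_, _, ⟨[p], l, rfl⟩, ?_⟩
        exact (mem_segment_horizontal hlr.le).2 ⟨rfl, by show _ ≤ a.1; linarith, hr.le⟩
      · show c ≤ a.2
        rcases hc with ⟨rfl, -⟩ | ⟨rfl, -⟩
        -- A point lower than the top would be inside the obstacle over which the path passes.
        · by_contra! hlt
          exact ha.2 R hR ⟨by linarith, hr, by linarith, hlt⟩
        · linarith
    · obtain ⟨t, ht, h⟩ := ih he hr h2 h3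
      exact ⟨t, ht.imp (fun ht => by simp [ht])
        fun ht => trace_mono (l' := p :: ((R.left : ℝ), c) :: ((R.right : ℝ), c) :: l)
          ⟨[p, ((R.left : ℝ), c), ((R.right : ℝ), c)], [], by simp⟩ ht, h⟩
  | aroundWall => exact absurd he (lt_irrefl _)

/-! ### The first point of a closed set on a segment -/

/-- The parameters at which the segment is in `G` form a nonempty compact set, which has a least
element. -/
lemma exists_first_hit {G : Set Point} (hG : IsClosed G) {p q : Point}
    (h : ∃ z ∈ segment ℝ p q, z ∈ G) : ∃ t ∈ Set.Icc (0 : ℝ) 1, p + t • (q - p) ∈ G ∧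
      p + t • (q - p) ∈ segment ℝ p q ∧
      ∀ z ∈ segment ℝ p (p + t • (q - p)), z ≠ p + t • (q - p) → z ∉ G := by
  have hne : (Set.Icc (0 : ℝ) 1 ∩ (fun t : ℝ => p + t • (q - p)) ⁻¹' G).Nonempty := by
    obtain ⟨z, hz, hzG⟩ := h
    rw [segment_eq_image'] at hz
    obtain ⟨t, ht, rfl⟩ := hz
    exact ⟨t, ht, hzG⟩
  obtain ⟨t, ⟨ht, htG⟩, hmin⟩ := (isCompact_Icc.inter_right (hG.preimage
    (by fun_prop : Continuous fun t : ℝ => p + t • (q - p)))).exists_isLeast hne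
  refine ⟨t, ht, htG, ?_, fun z hz hzne hzG => ?_⟩
  · rw [segment_eq_image']
    exact ⟨t, ht, rfl⟩
  · rw [segment_eq_image'] at hz
    obtain ⟨s, hs, rfl⟩ := hz
    have e : p + s • (p + t • (q - p) - p) = p + (s * t) • (q - p) := by
      rw [add_sub_cancel_left, smul_smul]
    simp only [e] at hzG hzne
    have hle : t ≤ s * t := hmin ⟨⟨mul_nonneg hs.1 ht.1, mul_le_one₀ hs.2 ht.1 ht.2⟩, hzG⟩
    have := le_antisymm hle (mul_le_of_le_one_left ht.1 hs.2)
    exact hzne (by rw [← this])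

/-! ### Greedy motion in general -/

namespace Greedy

variable {S : Scene} {dir : Point} {hit : Point → Point → Prop} {G : Set Point}

lemma head?_eq {p e : Point} {l : List Point} (h : Greedy S dir hit G p l e) :
    l.head? = some p := by
  cases h <;> rfl

lemma invariant {I : Point → Prop}
    (hahead : ∀ p q (s : ℝ), I p → 0 < s → q = p + s • dir → S.Free (segment ℝ p q) →
      (∀ z ∈ segment ℝ p q, z ≠ q → z ∉ G) → I q)
    (hslide : ∀ p c q, I p → hit p c → q ∈ segment ℝ p c →
      (∀ z ∈ segment ℝ p q, z ≠ q → z ∉ G) → I q)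
    {p e : Point} {l : List Point} (h : Greedy S dir hit G p l e) (hp : I p) : I e ∧ e ∈ G := by
  induction h with
  | done p h => exact ⟨hp, h⟩
  | ahead p q l e _ _ hs hfree hz _ _ ih =>
    obtain ⟨s, hs, hq⟩ := hs
    exact ih (hahead p q s hp hs hq hfree hz)
  | slide p c q l e _ hc hq _ hz _ _ ih => exact ih (hslide p c q hp hc hq hz)

/-- A move that meets the goal is cut at its first goal point, so only a move that avoids the goal
has to be continued. `exists_slide` does the same for slides. -/
lemma exists_ahead (hG : IsClosed G) {p q : Point} (hhit : ∀ c, ¬ hit p c)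
    (hs : ∃ s : ℝ, 0 < s ∧ q = p + s • dir) (hfree : S.Free (segment ℝ p q))
    (hq : (∀ z ∈ segment ℝ p q, z ∉ G) → (∃ c, hit q c) ∧ ∃ l e, Greedy S dir hit G q l e) :
    ∃ l e, Greedy S dir hit G p l e := by
  by_cases hpG : p ∈ G
  · exact ⟨_, _, Greedy.done p hpG⟩
  by_cases h : ∃ z ∈ segment ℝ p q, z ∈ G
  · obtain ⟨t, ht, htG, hmem, hmin⟩ := exists_first_hit hG h
    obtain ⟨s, hs, rfl⟩ := hs
    have ht0 : 0 < t := by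
      refine lt_of_le_of_ne ht.1 ?_
      rintro rfl
      simp at htG
      exact hpG htG
    refine ⟨_, _, Greedy.ahead p _ _ _ hpG hhit ⟨t * s, by positivity, ?_⟩ ?_ hmin (Or.inl htG)
      (Greedy.done _ htG)⟩
    · rw [add_sub_cancel_left, smul_smul]
    · intro z hz
      exact hfree z ((convex_segment p _).segment_subset (left_mem_segment ℝ _ _) hmem hz)
  · push Not at h
    obtain ⟨hc, l, e, hl⟩ := hq h
    exact ⟨_, _, Greedy.ahead p q l e hpG hhit hs hfree (fun z hz _ => h z hz) (Or.inr hc) hl⟩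

lemma exists_slide (hG : IsClosed G) {p c : Point} (hhit : hit p c) (hne : c ≠ p)
    (hc : (∀ z ∈ segment ℝ p c, z ∉ G) → ∃ l e, Greedy S dir hit G c l e) :
    ∃ l e, Greedy S dir hit G p l e := by
  by_cases hpG : p ∈ G
  · exact ⟨_, _, Greedy.done p hpG⟩
  by_cases h : ∃ z ∈ segment ℝ p c, z ∈ G
  · obtain ⟨t, ht, htG, hmem, hmin⟩ := exists_first_hit hG h
    refine ⟨_, _, Greedy.slide p c _ _ _ hpG hhit hmem ?_ hmin (Or.inl htG) (Greedy.done _ htG)⟩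
    intro h
    rw [h] at htG
    exact hpG htG
  · push Not at h
    obtain ⟨l, e, hl⟩ := hc h
    exact ⟨_, _, Greedy.slide p c c l e hpG hhit (right_mem_segment ℝ _ _) hne
      (fun z hz _ => h z hz) (Or.inr rfl) hl⟩

end Greedy

/-! ### Greedy motion down and left -/

/-- Move down until an obstacle or the line `y = h` is hit. -/
lemma Scene.exists_down (S : Scene) {p : Point} (hp : S.FreeAt p) {h : ℝ} (hh : h ≤ p.2) :
    ∃ y : ℝ, h ≤ y ∧ y ≤ p.2 ∧ S.Free (segment ℝ p (p.1, y)) ∧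
      (y = h ∨ ∃ R ∈ S.obstacles, R.BlocksDown (p.1, y)) := by
  obtain ⟨x, y₀⟩ := p
  simp only at hh ⊢
  have key : ∀ y, h ≤ y → y ≤ y₀ → (∀ R ∈ S.obstacles, R.left < x → x < R.right → h ≤ R.top →
      R.top ≤ y₀ → R.top ≤ y) → S.Free (segment ℝ ((x, y₀) : Point) (x, y)) := by
    intro y h1 h2 hR z hz
    rw [segment_symm, mem_segment_vertical h2] at hz
    refine ⟨hz.1.trans_le hp.1, fun R hRS hzR => ?_⟩
    obtain ⟨a, b, c, d⟩ := hzR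
    rw [hz.1] at a b
    rcases le_or_gt R.top y₀ with ht | ht
    · have := hR R hRS a b (by linarith) ht
      linarith
    · exact hp.2 R hRS ⟨a, b, by show _ < y₀; linarith, ht⟩
  set A : Set ℝ := {t | ∃ R ∈ S.obstacles, R.top = t ∧ R.left < x ∧ x < R.right ∧ h ≤ t ∧ t ≤ y₀}
    with hA
  by_cases hne : A.Nonempty
  · have hbdd : BddAbove A := ⟨y₀, by rintro t ⟨R, -, -, -, -, -, h⟩; exact h⟩
    -- Heights are not integral, but a top within `1` of the supremum is already the highest: an
    -- obstacle with a higher top in this range has height at least `1` and would overlap this one.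
    obtain ⟨t, htA, ht⟩ := exists_lt_of_lt_csSup hne (sub_one_lt (sSup A))
    obtain ⟨R, hR, rfl, h1, h2, h3, h4⟩ := htA
    refine ⟨R.top, h3, h4, key _ h3 h4 ?_, Or.inr ⟨R, hR, rfl, h1, h2⟩⟩
    intro R' hR' a b c d
    by_contra! hlt
    have hle : R'.top ≤ sSup A := le_csSup hbdd ⟨R', hR', rfl, a, b, c, d⟩
    have e1 : (R.left : ℝ) < R'.right := h1.trans b
    have e2 : (R'.left : ℝ) < R.right := a.trans h2
    have e3 := R'.one_le_height
    have := S.eq_of_overlap hR hR' (by exact_mod_cast e1) (by exact_mod_cast e2)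
      (R.bottom_lt_top.trans hlt) (by linarith)
    subst this
    exact lt_irrefl _ hlt
  · refine ⟨h, le_rfl, hh, key _ le_rfl hh ?_, Or.inl rfl⟩
    intro R hR a b c d
    exact absurd ⟨R.top, R, hR, rfl, a, b, c, d⟩ hne

/-- An obstacle on which the robot stands at this point straddles the line of the left edge of `R`,
and overlaps `R`. So left edges are barriers for slides to the left, and a fall from a top left
corner is at least as long as the obstacle is high. -/
lemma not_blocksDown_corner (S : Scene) {R R' : Obstacle} (hR : R ∈ S.obstacles)
    (hR' : R' ∈ S.obstacles) {y : ℝ} (h1 : R.bottom < y) (h2 : y ≤ R.top) :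
    ¬ R'.BlocksDown ((R.left : ℝ), y) := by
  rintro ⟨rfl, a, b⟩
  simp only at a b
  have a' : R'.left < R.left := by exact_mod_cast a
  have b' : R.left < R'.right := by exact_mod_cast b
  have := S.eq_of_overlap hR hR' b' (a'.trans R.left_lt_right) h1
    (R'.bottom_lt_top.trans_le h2)
  subst this
  exact lt_irrefl _ a'

/-- By `hline` the goal contains a horizontal line at or below the start. Consecutive slides differ
in height by at least `1`, the least height of an obstacle, so finitely many of them suffice. -/
lemma exists_greedyDownLeft (S : Scene) {G : Set Point} (hG : IsClosed G) {h : ℝ}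
    (hline : ∀ z : Point, z.2 = h → z ∈ G) {p : Point} (hp : S.FreeAt p) (hh : h ≤ p.2) :
    ∃ l e, GreedyDownLeft S G p l e := by
  have unblocked : ∀ p : Point, S.FreeAt p → h ≤ p.2 → (∀ R ∈ S.obstacles, ¬ R.BlocksDown p) →
      (∀ y, h ≤ y → y < p.2 → (∃ R ∈ S.obstacles, R.BlocksDown (p.1, y)) → S.FreeAt (p.1, y) →
        ∃ l e, GreedyDownLeft S G (p.1, y) l e) → ∃ l e, GreedyDownLeft S G p l e := by
    intro p hp hh hb hcont
    rcases hh.eq_or_lt with hh' | hh'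
    · exact ⟨_, _, Greedy.done p (hline p hh'.symm)⟩
    obtain ⟨y, h1, h2, hfree, hy⟩ := S.exists_down hp hh
    have hlt : y < p.2 := by
      refine lt_of_le_of_ne h2 ?_
      rintro rfl
      rcases hy with hy | ⟨R, hR, hy⟩
      · linarith
      · exact hb R hR hy
    refine Greedy.exists_ahead hG (q := (p.1, y)) ?_ ⟨p.2 - y, by linarith, ?_⟩ hfree ?_
    · rintro c ⟨R, hR, hb', -⟩
      exact hb R hR hb'
    · ext <;> simp
    · intro hz
      rcases hy with rfl | ⟨R, hR, hy⟩
      · exact absurd (hline _ rfl) (hz _ (right_mem_segment ℝ _ _))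
      · exact ⟨⟨_, R, hR, hy, rfl⟩, hcont y h1 hlt ⟨R, hR, hy⟩ (hfree _ (right_mem_segment ℝ _ _))⟩
  have blocked : ∀ N : ℕ, ∀ p : Point, S.FreeAt p → h ≤ p.2 → p.2 - h ≤ N →
      (∃ R ∈ S.obstacles, R.BlocksDown p) → ∃ l e, GreedyDownLeft S G p l e := by
    intro N
    induction N with
    | zero =>
      intro p _ hh hN _
      exact ⟨_, _, Greedy.done p (hline p (by push_cast at hN; linarith))⟩
    | succ N ih =>
      intro p hp hh hN ⟨R, hR, hb1, hb2, hb3⟩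
      have hlr : (R.left : ℝ) < R.right := by exact_mod_cast R.left_lt_right
      have hbt := R.one_le_height
      refine Greedy.exists_slide hG (c := ((R.left : ℝ), R.top)) ⟨R, hR, ⟨hb1, hb2, hb3⟩, rfl⟩
        (fun hc => hb2.ne (congrArg Prod.fst hc)) fun hz => ?_
      refine unblocked _ (S.freeAt_of_left (hb2.le.trans hp.1) hR rfl (by show _ ≤ R.top; linarith)
        le_rfl) (by show _ ≤ R.top; linarith) ?_ ?_
      · intro R' hR'
        exact not_blocksDown_corner S hR hR' (by linarith) le_rfl
      · rintro y h1 h2 ⟨R', hR', hb'⟩ hfree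
        refine ih _ hfree h1 ?_ ⟨R', hR', hb'⟩
        by_contra! hlt
        simp only at h2 hlt
        push_cast at hN
        exact not_blocksDown_corner S hR hR' (by linarith) h2.le hb'
  by_cases hb : ∃ R ∈ S.obstacles, R.BlocksDown p
  · obtain ⟨N, hN⟩ := exists_nat_ge (p.2 - h)
    exact blocked N p hp hh hN hb
  · push Not at hb
    refine unblocked p hp hh hb fun y h1 h2 hby hfree => ?_
    obtain ⟨N, hN⟩ := exists_nat_ge (y - h)
    exact blocked N _ hfree h1 hN hby

/-- Induction along a greedy down-left path. -/
lemma GreedyDownLeft.invariant {S : Scene} {G : Set Point} {I : Point → Prop}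
    (hdown : ∀ x y y', I (x, y) → y' < y → (∀ w, y' < w → w ≤ y → (x, w) ∉ G) → I (x, y'))
    (hleft : ∀ x x' y, I (x, y) → ∀ R ∈ S.obstacles, R.BlocksDown (x, y) → (R.left : ℝ) ≤ x' →
      x' ≤ x → I (x', y))
    {p e : Point} {l : List Point} (h : GreedyDownLeft S G p l e) (hp : I p) (hfree : S.FreeAt p) :
    e ∈ G ∧ I e ∧ S.FreeAt e ∧ e.1 ≤ p.1 := by
  refine and_comm.1 (Greedy.invariant (I := fun z => I z ∧ S.FreeAt z ∧ z.1 ≤ p.1)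
    ?_ ?_ h ⟨hp, hfree, le_rfl⟩)
  · rintro ⟨x, y⟩ q s ⟨hI, -, hx⟩ hs rfl hf hG
    have e : ((x, y) : Point) + s • (0, -1) = (x, y - s) := by ext <;> simp [sub_eq_add_neg]
    simp only [e] at hf hG ⊢
    refine ⟨hdown x y _ hI (by linarith) ?_, hf _ (right_mem_segment ℝ _ _), hx⟩
    intro w h1 h2
    refine hG _ ?_ fun h => h1.ne' (congrArg Prod.snd h)
    rw [segment_symm, mem_segment_vertical (by linarith)]
    exact ⟨rfl, h1.le, h2⟩
  · rintro ⟨x, y⟩ c ⟨x', y'⟩ ⟨hI, hf, hx⟩ ⟨R, hR, hb, rfl⟩ hq -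
    have hlt : (R.left : ℝ) < x := hb.2.1
    have hgt : x < R.right := hb.2.2
    have hy : y = R.top := hb.1
    rw [segment_symm, ← hy, mem_segment_horizontal hlt.le] at hq
    obtain ⟨rfl, h1, h2⟩ := hq
    simp only at h1 h2 hx
    exact ⟨hleft x x' _ hI R hR hb h1 h2, S.freeAt_of_top_or_bottom (h2.trans hf.1) hR h1
      (by show x' ≤ _; linarith) (Or.inl hy), h2.trans hx⟩

/-- A robot to the right of the left edge of `R` that slides to the left along the top of an
obstacle, at a height between the bottom and the top of `R`, does not get past this edge. -/
lemma left_le_of_blocksDown (S : Scene) {R R' : Obstacle} (hR : R ∈ S.obstacles)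
    (hR' : R' ∈ S.obstacles) {x y x' : ℝ} (hb : R'.BlocksDown (x, y)) (hx' : (R'.left : ℝ) ≤ x')
    (hx : (R.left : ℝ) ≤ x) (h1 : R.bottom < y) (h2 : y ≤ R.top) : (R.left : ℝ) ≤ x' := by
  by_contra! hlt
  obtain ⟨rfl, a, b⟩ := hb
  exact not_blocksDown_corner S hR hR' h1 h2 ⟨rfl, hx'.trans_lt hlt, hx.trans_lt b⟩

/-! ### Greedy motion right and down -/

lemma isClosed_postSegment (τ : ℝ) (p : Point) : IsClosed (postSegment τ p) :=
  (isClosed_eq continuous_fst continuous_const).inter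
    ((isClosed_le continuous_const continuous_snd).inter
      (isClosed_le continuous_snd continuous_const))

/-- An obstacle with the same left edge that covers this height overlaps `R`. So the robot gets on
to the right after each slide down. -/
lemma not_blocksRight_corner (S : Scene) {R R' : Obstacle} (hR : R ∈ S.obstacles)
    (hR' : R' ∈ S.obstacles) : ¬ R'.BlocksRight ((R.left : ℝ), R.bottom) := by
  rintro ⟨a, b, c⟩
  simp only at a b c
  have a' : R.left = R'.left := by exact_mod_cast a
  have h1 := R.left_lt_right
  have h2 := R'.left_lt_right
  have := S.eq_of_overlap hR hR' (by omega) (by omega) c (b.trans R.bottom_lt_top)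
  subst this
  exact lt_irrefl _ b

/-- From a point above an `x`-monotone path to a post, at most `τ` above the post, the robot
reaches the path or the post. -/
lemma exists_greedyRightDown (S : Scene) {L : List Point} (hL : XMonotone L) {P : Point}
    (hP : P ∈ trace L) (hPn : P.1 ≤ S.n) {τ : ℝ} (hτ : 0 < τ) {p : Point} (hp : S.FreeAt p)
    (habove : p ∈ aboveTrace L) (hpP : p.1 ≤ P.1) (hpτ : p.2 ≤ P.2 + τ) :
    ∃ l e, GreedyRightDown S (postSegment τ P ∪ trace L) p l e := by
  have hG : IsClosed (postSegment τ P ∪ trace L) :=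
    (isClosed_postSegment τ P).union (isCompact_trace L).isClosed
  -- On the vertical line of the post, what is above the path is on the path if it is not higher
  -- than `P`, and on the upper half of the post otherwise. So the motion cannot get past the post.
  have hend : ∀ z : Point, z ∈ aboveTrace L → z.1 = P.1 → z.2 ≤ P.2 + τ →
      z ∈ postSegment τ P ∪ trace L := by
    intro z hz h1 h2
    rcases le_or_gt z.2 P.2 with h | h
    · exact Or.inr (mem_trace_of_above_of_below hL hz ⟨P, hP, h1.symm, h⟩)
    · exact Or.inl ⟨h1, by linarith, h2⟩
  have unblocked : ∀ p : Point, S.FreeAt p → p ∈ aboveTrace L → p.1 ≤ P.1 → p.2 ≤ P.2 + τ →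
      (∀ R ∈ S.obstacles, ¬ R.BlocksRight p) →
      (∀ q : Point, p.1 < q.1 → q.1 ≤ P.1 → q.2 = p.2 → (∃ R ∈ S.obstacles, R.BlocksRight q) →
        q ∈ aboveTrace L → ∃ l e, GreedyRightDown S (postSegment τ P ∪ trace L) q l e) →
      ∃ l e, GreedyRightDown S (postSegment τ P ∪ trace L) p l e := by
    intro p hp habove hpP hpτ hb hcont
    rcases hpP.eq_or_lt with hpP' | hpP'
    · exact ⟨_, _, Greedy.done p (hend p habove hpP' hpτ)⟩
    obtain ⟨q, hq2, h1, h2, hfree, hq⟩ := S.exists_right hp hpP hPn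
    have hlt : p.1 < q.1 := by
      refine lt_of_le_of_ne h1 fun heq => ?_
      have : q = p := Prod.ext heq.symm hq2
      subst this
      rcases hq with hq | ⟨R, hR, hq⟩
      · linarith
      · exact hb R hR hq
    refine Greedy.exists_ahead hG (q := q) ?_ ⟨q.1 - p.1, by linarith, ?_⟩ hfree ?_
    · rintro c ⟨R, hR, hb', -⟩
      exact hb R hR hb'
    · ext <;> simp [hq2]
    · intro hz
      have hqa := above_of_segment_disjoint hL habove h1 hP h2 fun z hzs hzt =>
        hz z hzs (Or.inr hzt)
      rcases hq with hq | ⟨R, hR, hq⟩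
      · exact absurd (hend q hqa hq (by linarith)) (hz q (right_mem_segment ℝ _ _))
      · exact ⟨⟨_, R, hR, hq, rfl⟩, hcont q hlt h2 hq2 ⟨R, hR, hq⟩ hqa⟩
  have blocked : ∀ N : ℕ, ∀ p : Point, p ∈ aboveTrace L → p.1 ≤ P.1 → p.2 ≤ P.2 + τ →
      P.1 - p.1 ≤ N → (∃ R ∈ S.obstacles, R.BlocksRight p) →
      ∃ l e, GreedyRightDown S (postSegment τ P ∪ trace L) p l e := by
    intro N
    induction N with
    | zero =>
      intro p habove hpP hpτ hN _
      exact ⟨_, _, Greedy.done p (hend p habove (by push_cast at hN; linarith) hpτ)⟩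
    | succ N ih =>
      intro p habove hpP hpτ hN ⟨R, hR, hb1, hb2, hb3⟩
      refine Greedy.exists_slide hG (c := ((R.left : ℝ), R.bottom)) ⟨R, hR, ⟨hb1, hb2, hb3⟩, rfl⟩
        (fun hc => hb2.ne (congrArg Prod.snd hc)) fun hz => ?_
      have hca := above_of_segment_disjoint hL habove hb1.le hP (by show (R.left : ℝ) ≤ _; linarith)
        fun z hzs hzt => hz z hzs (Or.inr hzt)
      refine unblocked _ (S.freeAt_of_left (by show (R.left : ℝ) ≤ _; linarith) hR rfl le_rfl
        R.bottom_lt_top.le) hca (by show (R.left : ℝ) ≤ _; linarith)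
        (by show R.bottom ≤ _; linarith) (fun R' hR' => not_blocksRight_corner S hR hR') ?_
      rintro q h1 h2 h3 ⟨R', hR', hb'⟩ hqa
      refine ih q hqa h2 (by rw [h3]; show R.bottom ≤ _; linarith) ?_ ⟨R', hR', hb'⟩
      have hq1 := hb'.1
      rw [hq1] at h1 ⊢
      simp only at h1
      -- Integrality of the left edges makes every advance between two slides at least `1`, which
      -- bounds the number of slides.
      have : (R.left : ℝ) + 1 ≤ R'.left := by
        have h : R.left < R'.left := by exact_mod_cast h1
        exact_mod_cast h
      push_cast at hN
      linarith
  by_cases hb : ∃ R ∈ S.obstacles, R.BlocksRight p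
  · obtain ⟨N, hN⟩ := exists_nat_ge (P.1 - p.1)
    exact blocked N p habove hpP hpτ hN hb
  · push Not at hb
    refine unblocked p hp habove hpP hpτ hb fun q h1 h2 h3 hbq hqa => ?_
    obtain ⟨N, hN⟩ := exists_nat_ge (P.1 - q.1)
    exact blocked N q hqa h2 (by linarith) hN hbq

/-! ### Lists -/

lemma pair_infix_append {α : Type*} {u v : α} {A B : List α} (h : [u, v] <:+: A ++ B) :
    [u, v] <:+: A ∨ [u, v] <:+: B ∨ (A.getLast? = some u ∧ B.head? = some v) := by
  induction A with
  | nil => exact Or.inr (Or.inl h)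
  | cons a A ih =>
    rcases pair_infix_cons h with ⟨rfl, hv⟩ | h
    · cases A with
      | nil => exact Or.inr (Or.inr ⟨rfl, hv⟩)
      | cons b A =>
        obtain rfl : b = v := Option.some.inj hv
        exact Or.inl ⟨[], A, rfl⟩
    · rcases ih h with h | h | ⟨h1, h2⟩
      · exact Or.inl (List.infix_cons h)
      · exact Or.inr (Or.inl h)
      · refine Or.inr (Or.inr ⟨?_, h2⟩)
        rw [List.getLast?_cons, h1]
        rfl

lemma aboveTrace_mono {l l' : List Point} (h : l <:+: l') : aboveTrace l ⊆ aboveTrace l' := by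
  rintro z ⟨t, ht, h'⟩
  exact ⟨t, trace_mono h ht, h'⟩

/-- A path from the right to the left of the line `x = c` can be followed until it reaches this
line for the first time, in the middle or at the end of a piece that is not vertical. -/
lemma exists_followUntil {c : ℝ} {L : List Point} : ∀ w : Point, L.head? = some w → c < w.1 →
    (∃ z ∈ L, z.1 ≤ c) → ∃ l a u v, FollowUntil L c l a ∧ l.head? = some w ∧ [u, v] <:+: L ∧
      c < u.1 ∧ v.1 ≤ c ∧ a ∈ segment ℝ u v ∧ a.1 = c := by
  induction L with
  | nil => intro w h; simp at h
  | cons w L ih =>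
    intro w' hw hc ⟨z, hz, hzc⟩
    simp only [List.head?_cons, Option.some.injEq] at hw
    subst hw
    have hzL : z ∈ L := by
      rcases List.mem_cons.1 hz with rfl | hz
      · linarith
      · exact hz
    match L, ih, hzL with
    | v :: L, ih, hzL =>
      rcases le_or_gt v.1 c with hv | hv
      · obtain ⟨a, ha, hac⟩ := (convex_segment w v).isPreconnected.intermediate_value
          (right_mem_segment ℝ w v) (left_mem_segment ℝ w v) continuous_fst.continuousOn
          (show c ∈ Set.Icc v.1 w.1 from ⟨hv, hc.le⟩)
        refine ⟨[w, a], a, w, v, ⟨[], w, v, L, rfl, ha, hac, rfl, ?_⟩, rfl, ⟨[], L, rfl⟩, hc, hv,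
          ha, hac⟩
        intro z hz hzc
        rw [trace_cons_cons, trace_of_length_le (l := [a]) (by simp), Set.union_empty,
          segment_eq_image'] at hz
        obtain ⟨t, ht, rfl⟩ := hz
        -- The abscissa is affine on the piece from `w` to `a`, and larger than `c` at `w`, so it is
        -- `c` only at `a`.
        have e : (1 - t) * (w.1 - c) = 0 := by
          simp only [Prod.fst_add, Prod.smul_fst, Prod.fst_sub, smul_eq_mul, hac] at hzc
          linarith
        rcases mul_eq_zero.1 e with h | h
        · have : t = 1 := by linarith
          simp [this]
        · linarith
      · obtain ⟨l, a, u, v', ⟨pre, u', v'', suf, e1, h1, h2, e2, h3⟩, hh, hinf, h⟩ :=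
          ih v rfl hv ⟨z, hzL, hzc⟩
        refine ⟨w :: l, a, u, v', ⟨w :: pre, u', v'', suf, by simp [e1], h1, h2, by simp [e2], ?_⟩,
          rfl, List.infix_cons hinf, h⟩
        obtain ⟨l', rfl⟩ : ∃ l', l = v :: l' := by
          cases l with
          | nil => simp at hh
          | cons b l => simp at hh; exact ⟨l, by rw [hh]⟩
        intro z hz hzc
        rw [trace_cons_cons] at hz
        rcases hz with hz | hz
        · rcases le_total w.1 v.1 with h | h
          · have := (fst_mem_of_mem_segment h hz).1
            linarith
          · rw [segment_symm] at hz
            have := (fst_mem_of_mem_segment h hz).1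
            linarith
        · exact h3 z hz hzc

/-! ### Edges -/

section Edge

variable {S : Scene} {τ y : ℝ} {P P' : Point} {l : List Point}

lemma TauPath.edge_mem_bounds (h : TauPath S τ (P.1, y) l P') (he : P'.1 < S.n) :
    ∀ z ∈ P :: l, P.1 ≤ z.1 ∧ z.1 ≤ P'.1 := by
  intro z hz
  rcases List.mem_cons.1 hz with rfl | hz
  · exact ⟨le_rfl, h.fst_le he⟩
  · exact h.mem_bounds he z hz

lemma TauPath.edge_xMonotone (h : TauPath S τ (P.1, y) l P') (he : P'.1 < S.n) :
    XMonotone (P :: l) :=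
  List.pairwise_cons.2 ⟨fun z hz => (h.mem_bounds he z hz).1, h.pairwise he⟩

lemma TauPath.edge_getLast? (h : TauPath S τ (P.1, y) l P') : (P :: l).getLast? = some P' := by
  simp [List.getLast?_cons, h.getLast?_eq]

lemma TauPath.edge_length (h : TauPath S τ (P.1, y) l P') : 2 ≤ (P :: l).length := by
  have := h.head?_eq
  cases l with
  | nil => simp at this
  | cons => simp

lemma TauPath.edge_horizontalPiece (h : TauPath S τ (P.1, y) l P') (he : P'.1 < S.n)
    {u v : Point} (huv : [u, v] <:+: P :: l) (hlt : u.1 < v.1) :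
    P.1 ≤ u.1 ∧ S.HorizontalPiece τ y u v := by
  rcases pair_infix_cons huv with ⟨rfl, hv⟩ | huv
  · rw [h.head?_eq] at hv
    cases hv
    exact absurd hlt (lt_irrefl _)
  · exact h.horizontalPiece he huv hlt

lemma TauPath.edge_above (h : TauPath S τ (P.1, y) l P') (he : P'.1 < S.n) {a : Point}
    (ha : S.FreeAt a) (h1 : P.1 ≤ a.1) (h2 : a.1 ≤ P'.1) (h3 : y ≤ a.2) :
    a ∈ aboveTrace (P :: l) := by
  obtain ⟨t, ht, h'⟩ := h.exists_le he ha h1 h2 h3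
  refine ⟨t, ?_, h'⟩
  rcases ht with ht | ht
  · exact mem_trace_of_mem h.edge_length (List.mem_cons_of_mem _ ht)
  · exact trace_mono (List.infix_cons List.infix_rfl) ht

end Edge

/-! ### The part of the tree that has been found -/

/-- The posts `post j r` with `1 ≤ j` and `1 ≤ r ≤ cnt j` form a part of the fence-tree with root
`P₀`, in which `branch j r` is the path from the root to `post j r`, and the robot has walked
along all edges. -/
structure FoundTree (S : Scene) (τ : ℝ) (P₀ : Point) (cnt : ℕ → ℕ) (post : ℕ → ℕ → Point)
    (branch : ℕ → ℕ → List Point) (walk : List Point) : Prop where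
  root : post 1 1 = P₀ ∧ branch 1 1 = [P₀]
  anti : ∀ j, 1 ≤ j → cnt (j + 1) ≤ cnt j
  -- The height depends only on the indices: an up-edge adds `τ` and increases `r`, a down-edge
  -- subtracts `τ` and increases `j`.
  node : ∀ j r, 1 ≤ j → 1 ≤ r → r ≤ cnt j → (post j r).1 < S.n ∧ S.IsPost τ (post j r) ∧
    (post j r).2 = P₀.2 + ((r : ℝ) - j) * τ ∧ post j r ∈ walk
  edge : ∀ j r, 1 ≤ j → 1 ≤ r → r ≤ cnt j → (j, r) ≠ (1, 1) → ∃ path, path <:+: walk ∧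
    ((2 ≤ r ∧ (j = 1 ∨ (post (j - 1) r).1 ≤ (post j (r - 1)).1) ∧
      UpEdge S τ (post j (r - 1)) path (post j r) ∧ branch j r = branch j (r - 1) ++ path) ∨
    (2 ≤ j ∧ (r = 1 ∨ (post j (r - 1)).1 < (post (j - 1) r).1) ∧
      DownEdge S τ (post (j - 1) r) path (post j r) ∧ branch j r = branch (j - 1) r ++ path))

namespace FoundTree

variable {S : Scene} {τ : ℝ} {P₀ : Point} {cnt : ℕ → ℕ} {post : ℕ → ℕ → Point}
  {branch : ℕ → ℕ → List Point} {walk : List Point}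

/-- The last edge on the branch to a post. -/
lemma edge_cases (T : FoundTree S τ P₀ cnt post branch walk) {C : ℕ → ℕ → Prop}
    (up : ∀ j r l, 1 ≤ j → 1 ≤ r → r + 1 ≤ cnt j →
      (j = 1 ∨ (post (j - 1) (r + 1)).1 ≤ (post j r).1) →
      TauPath S τ ((post j r).1, (post j r).2 + τ) l (post j (r + 1)) →
      branch j (r + 1) = branch j r ++ post j r :: l → C j (r + 1))
    (down : ∀ j r l, 1 ≤ j → 1 ≤ r → r ≤ cnt (j + 1) →
      (r = 1 ∨ (post (j + 1) (r - 1)).1 < (post j r).1) →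
      TauPath S τ ((post j r).1, (post j r).2 - τ) l (post (j + 1) r) →
      branch (j + 1) r = branch j r ++ post j r :: l → C (j + 1) r)
    {j r : ℕ} (hj : 1 ≤ j) (hr : 1 ≤ r) (hc : r ≤ cnt j) (hne : (j, r) ≠ (1, 1)) : C j r := by
  obtain ⟨path, -, ⟨h1, h2, ⟨l, h3, rfl⟩, h4⟩ | ⟨h1, h2, ⟨l, h3, rfl⟩, h4⟩⟩ :=
    T.edge j r hj hr hc hne
  · obtain ⟨r, rfl⟩ : ∃ r', r = r' + 1 := ⟨r - 1, by omega⟩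
    exact up j r l hj (by omega) hc h2 h3 h4
  · obtain ⟨j, rfl⟩ : ∃ j', j = j' + 1 := ⟨j - 1, by omega⟩
    exact down j r l (by omega) hr hc h2 h3 h4

/-- Induction along the branches; by `anti` the parent of a found post has been found as well. -/
lemma induction (T : FoundTree S τ P₀ cnt post branch walk) {C : ℕ → ℕ → Prop} (h11 : C 1 1)
    (up : ∀ j r l, 1 ≤ j → 1 ≤ r → r + 1 ≤ cnt j →
      TauPath S τ ((post j r).1, (post j r).2 + τ) l (post j (r + 1)) →
      branch j (r + 1) = branch j r ++ post j r :: l → C j r → C j (r + 1))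
    (down : ∀ j r l, 1 ≤ j → 1 ≤ r → r ≤ cnt (j + 1) →
      TauPath S τ ((post j r).1, (post j r).2 - τ) l (post (j + 1) r) →
      branch (j + 1) r = branch j r ++ post j r :: l → C j r → C (j + 1) r)
    {j r : ℕ} (hj : 1 ≤ j) (hr : 1 ≤ r) (hc : r ≤ cnt j) : C j r := by
  obtain ⟨N, hN⟩ : ∃ N, j + r = N := ⟨_, rfl⟩
  induction N generalizing j r with
  | zero => omega
  | succ N ih =>
    by_cases hne : (j, r) = (1, 1)
    · cases hne
      exact h11
    · refine T.edge_cases (C := fun j r => j + r = N + 1 → C j r) ?_ ?_ hj hr hc hne hN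
      · intro j r l hj hr hc _ hl hb hN
        exact up j r l hj hr hc hl hb (ih hj hr (by omega) (by omega))
      · intro j r l hj hr hc _ hl hb hN
        exact down j r l hj hr hc hl hb (ih hj hr (hc.trans (T.anti j hj)) (by omega))

/-- An up-child of the preceding post is reached by moving right. A down-child has a parent that is
farther right than the preceding post, by the parent rule. `le_down` exchanges the two roles. -/
lemma le_right (T : FoundTree S τ P₀ cnt post branch walk) {j r : ℕ} (hj : 1 ≤ j) (hr : 1 ≤ r)
    (hc : r + 1 ≤ cnt j) : (post j r).1 ≤ (post j (r + 1)).1 := by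
  refine T.edge_cases (C := fun j r' => r' = r + 1 → (post j r).1 ≤ (post j r').1) ?_ ?_ hj
    (r := r + 1) (by omega) hc (by simp; omega) rfl
  · intro j r' l hj _ hc' _ hl _ h
    obtain rfl : r' = r := by omega
    exact hl.fst_le (T.node j _ hj (by omega) hc').1
  · rintro j r' l hj hr' hc (h | h) hl _ rfl
    · omega
    · exact h.le.trans (hl.fst_le (T.node (j + 1) _ (by omega) (by omega) hc).1)

lemma le_down (T : FoundTree S τ P₀ cnt post branch walk) {j r : ℕ} (hj : 1 ≤ j) (hr : 1 ≤ r)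
    (hc : r ≤ cnt (j + 1)) : (post j r).1 ≤ (post (j + 1) r).1 := by
  refine T.edge_cases (C := fun j' r => j' = j + 1 → (post j r).1 ≤ (post j' r).1) ?_ ?_
    (j := j + 1) (by omega) hr hc (by simp; omega) rfl
  · rintro j' r l hj' hr hc (h | h) hl _ rfl
    · omega
    · exact h.trans (hl.fst_le (T.node _ _ hj' (by omega) hc).1)
  · rintro j' r l hj' hr hc' _ hl _ h
    obtain rfl : j' = j := by omega
    exact hl.fst_le (T.node _ _ (by omega) (by omega) hc').1

lemma le_right_of_le (T : FoundTree S τ P₀ cnt post branch walk) {j r r' : ℕ} (hj : 1 ≤ j)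
    (hr : 1 ≤ r) (h : r ≤ r') (hc : r' ≤ cnt j) : (post j r).1 ≤ (post j r').1 := by
  induction r', h using Nat.le_induction with
  | base => exact le_rfl
  | succ r' h ih => exact (ih (by omega)).trans (T.le_right hj (by omega) hc)

lemma cnt_anti (T : FoundTree S τ P₀ cnt post branch walk) {j j' : ℕ} (hj : 1 ≤ j) (h : j ≤ j') :
    cnt j' ≤ cnt j := by
  induction j', h using Nat.le_induction with
  | base => exact le_rfl
  | succ j' h ih => exact (T.anti j' (by omega)).trans ih

lemma le_down_of_le (T : FoundTree S τ P₀ cnt post branch walk) {j j' r : ℕ} (hj : 1 ≤ j)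
    (hr : 1 ≤ r) (h : j ≤ j') (hc : r ≤ cnt j') : (post j r).1 ≤ (post j' r).1 := by
  induction j', h using Nat.le_induction with
  | base => exact le_rfl
  | succ j' h ih =>
    exact (ih (hc.trans (T.anti j' (by omega)))).trans (T.le_down (by omega) hr hc)

lemma branch_spec (T : FoundTree S τ P₀ cnt post branch walk) {j r : ℕ} (hj : 1 ≤ j) (hr : 1 ≤ r)
    (hc : r ≤ cnt j) : (branch j r).getLast? = some (post j r) ∧ XMonotone (branch j r) ∧
      P₀ ∈ branch j r ∧ (∀ z ∈ branch j r, z.1 ≤ (post j r).1) ∧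
      ((j, r) ≠ (1, 1) → 2 ≤ (branch j r).length) := by
  have step : ∀ {A : List Point} {P P' : Point} {y : ℝ} {l : List Point},
      TauPath S τ (P.1, y) l P' → P'.1 < S.n → XMonotone A → P₀ ∈ A → (∀ z ∈ A, z.1 ≤ P.1) →
      (A ++ P :: l).getLast? = some P' ∧ XMonotone (A ++ P :: l) ∧ P₀ ∈ A ++ P :: l ∧
        (∀ z ∈ A ++ P :: l, z.1 ≤ P'.1) ∧ 2 ≤ (A ++ P :: l).length := by
    intro A P P' y l hl he h1 h2 h3
    have hb := hl.edge_mem_bounds he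
    refine ⟨by simp [hl.getLast?_eq, List.getLast?_cons], ?_, by simp [h2], ?_, ?_⟩
    · refine List.pairwise_append.2 ⟨h1, hl.edge_xMonotone he, fun a ha b hb' => ?_⟩
      exact (h3 a ha).trans (hb b hb').1
    · intro z hz
      rcases List.mem_append.1 hz with hz | hz
      · exact (h3 z hz).trans (hl.fst_le he)
      · exact (hb z hz).2
    · have := hl.edge_length
      rw [List.length_append]
      omega
  refine T.induction (C := fun j r => (branch j r).getLast? = some (post j r) ∧
    XMonotone (branch j r) ∧ P₀ ∈ branch j r ∧ (∀ z ∈ branch j r, z.1 ≤ (post j r).1) ∧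
      ((j, r) ≠ (1, 1) → 2 ≤ (branch j r).length)) ?_ ?_ ?_ hj hr hc
  · simp [T.root.1, T.root.2, XMonotone]
  · rintro j r l hj hr hc hl hb ⟨-, h1, h2, h3, -⟩
    obtain ⟨a, b, c, d, e⟩ := step hl (T.node _ _ hj (by omega) hc).1 h1 h2 h3
    rw [hb]
    exact ⟨a, b, c, d, fun _ => e⟩
  · rintro j r l hj hr hc hl hb ⟨-, h1, h2, h3, -⟩
    obtain ⟨a, b, c, d, e⟩ := step hl (T.node _ _ (by omega) hr hc).1 h1 h2 h3
    rw [hb]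
    exact ⟨a, b, c, d, fun _ => e⟩

lemma post_mem_trace (T : FoundTree S τ P₀ cnt post branch walk) {j r : ℕ} (hj : 1 ≤ j)
    (hr : 1 ≤ r) (hc : r ≤ cnt j) (hne : (j, r) ≠ (1, 1)) : post j r ∈ trace (branch j r) := by
  obtain ⟨h1, -, -, -, h2⟩ := T.branch_spec hj hr hc
  exact mem_trace_of_mem (h2 hne) (List.mem_of_getLast? h1)

lemma height (T : FoundTree S τ P₀ cnt post branch walk) {j r : ℕ} (hj : 1 ≤ j) (hr : 1 ≤ r)
    (hc : r ≤ cnt j) : (post j r).2 = P₀.2 + ((r : ℝ) - j) * τ := (T.node j r hj hr hc).2.2.1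

/-- Followed backward from its end, the branch runs along fence `i + 1` by up-edges until it comes
down from fence `i`, at an abscissa not beyond that of `post i q`. All these edges run at heights up
to that of `post (i + 1) q`, and over an obstacle only where a free point at this height is still
higher. -/
lemma mem_aboveTrace (T : FoundTree S τ P₀ cnt post branch walk) (hτ : 0 < τ) {i q : ℕ}
    (hi : 1 ≤ i) (hq : 1 ≤ q) (hc : q ≤ cnt (i + 1)) {a : Point} (ha : S.FreeAt a)
    (h1 : (post i q).1 ≤ a.1) (h2 : a.1 ≤ (post (i + 1) q).1) (h3 : (post (i + 1) q).2 ≤ a.2) :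
    a ∈ aboveTrace (branch (i + 1) q) := by
  induction q, hq using Nat.le_induction with
  | base =>
    refine T.edge_cases (C := fun j r => j = i + 1 → r = 1 → a ∈ aboveTrace (branch j r)) ?_ ?_
      (j := i + 1) (by omega) le_rfl hc (by simp; omega) rfl rfl
    · intros
      omega
    · intro j r l hj hr hc _ hl hb hji hr1
      obtain rfl : j = i := by omega
      subst hr1
      rw [hb]
      refine aboveTrace_mono (List.suffix_append _ _).isInfix
        (hl.edge_above (T.node _ _ (by omega) hr hc).1 ha h1 h2 ?_)
      have e1 := T.height hj hr (hc.trans (T.anti _ hj))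
      have e2 := T.height (j := j + 1) (by omega) hr hc
      push_cast at e1 e2
      linarith
  | succ q hq ih =>
    refine T.edge_cases (C := fun j r => j = i + 1 → r = q + 1 → a ∈ aboveTrace (branch j r)) ?_ ?_
      (j := i + 1) (r := q + 1) (by omega) (by omega) hc (by simp; omega) rfl rfl
    · intro j r l hj hr hc' hpar hl hb hji hrq
      obtain rfl : r = q := by omega
      subst hji
      have e1 := T.height (j := i + 1) (r := r) (by omega) hr (by omega)
      have e2 := T.height (j := i + 1) (r := r + 1) (by omega) (by omega) hc
      push_cast at e1 e2
      rw [hb]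
      rcases le_total (post (i + 1) r).1 a.1 with h | h
      · refine aboveTrace_mono (List.suffix_append _ _).isInfix
          (hl.edge_above (T.node _ _ (by omega) (by omega) hc).1 ha h h2 ?_)
        linarith
      · refine aboveTrace_mono (List.prefix_append _ _).isInfix (ih (by omega) ?_ h ?_)
        · exact (T.le_right hi hr (hc.trans (T.anti _ hi))).trans h1
        · nlinarith
    · intro j r l hj hr hc' _ hl hb hji hrq
      obtain rfl : j = i := by omega
      subst hrq
      rw [hb]
      refine aboveTrace_mono (List.suffix_append _ _).isInfix
        (hl.edge_above (T.node _ _ (by omega) hr hc).1 ha h1 h2 ?_)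
      have e1 := T.height hj hr (hc.trans (T.anti _ hj))
      have e2 := T.height (j := j + 1) (by omega) hr hc
      push_cast at e1 e2
      linarith

end FoundTree

/-! ### `GoDown` -/

lemma GoDown.head?_eq {S : Scene} {τ : ℝ} {post : ℕ → ℕ → Point} {branch : ℕ → ℕ → List Point}
    {i m q : ℕ} {p e : Point} {path : List Point} (h : GoDown S τ post branch i m q p path e) :
    path.head? = some p := by
  obtain ⟨-, l₁, a, l₂, b, l₃, h1, -, -, rfl, -⟩ := h
  simp [Greedy.head?_eq h1]

lemma GoDown.end_eq {S : Scene} {τ : ℝ} {post : ℕ → ℕ → Point} {branch : ℕ → ℕ → List Point}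
    {i m q : ℕ} {p e : Point} {path : List Point} (h : GoDown S τ post branch i m q p path e)
    (hb : (branch (i + 1) q).getLast? = some (post (i + 1) q)) : e = post (i + 1) q := by
  obtain ⟨-, l₁, a, l₂, b, l₃, -, -, ⟨-, rfl⟩ | ⟨pre, u, v, suf, h1, -, rfl⟩, rfl, he⟩ := h
  · simpa using he.symm
  · rw [h1] at hb
    simp only [List.getLast?_append, List.getLast?_cons_cons] at hb he
    rw [he] at hb
    simpa using hb

lemma GoBackDown.head?_eq {S : Scene} {τ : ℝ} {post : ℕ → ℕ → Point}
    {branch : ℕ → ℕ → List Point} {i m q : ℕ} {p e : Point} {path : List Point}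
    (h : GoBackDown S τ post branch i m q p path e)
    (hb : (branch i m).getLast? = some (post i m)) : path.head? = some p := by
  obtain ⟨⟨rfl, -⟩, l₁, a, l₂, b, l₃, b', l₄, ⟨pre, u, v, suf, e1, -, -, rfl, -⟩, -, -, -, rfl⟩ := h
  rw [← List.head?_reverse, e1] at hb
  cases pre <;> simpa using hb

lemma GoBackDown.end_eq {S : Scene} {τ : ℝ} {post : ℕ → ℕ → Point}
    {branch : ℕ → ℕ → List Point} {i m q : ℕ} {p e : Point} {path : List Point}
    (h : GoBackDown S τ post branch i m q p path e)
    (hb : (branch (i + 1) q).getLast? = some (post (i + 1) q)) : e = post (i + 1) q := by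
  obtain ⟨-, l₁, a, l₂, b, l₃, b', l₄, -, -, -, h, -⟩ := h
  exact h.end_eq hb

namespace FoundTree

variable {S : Scene} {τ : ℝ} {P₀ : Point} {cnt : ℕ → ℕ} {post : ℕ → ℕ → Point}
  {branch : ℕ → ℕ → List Point} {walk : List Point}

/-- `GoDown` can be carried out. -/
lemma exists_goDown (T : FoundTree S τ P₀ cnt post branch walk) (hτ : 0 < τ) {i m q : ℕ}
    (hi : 1 ≤ i) (hq : 1 ≤ q) (hqm : q ≤ m) (hm : m ≤ cnt i) (hqc : q ≤ cnt (i + 1)) {p : Point}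
    (hp : S.FreeAt p) (h1 : (post i m).1 ≤ p.1) (h2 : p.1 ≤ (post (i + 1) q).1)
    (h3 : (post (i + 1) q).2 ≤ p.2) (h4 : p.2 ≤ (post i m).2) :
    ∃ path e, GoDown S τ post branch i m q p path e := by
  have hY : ∀ s, 1 ≤ s → s ≤ cnt i → (post i s).2 = P₀.2 + ((s : ℝ) - i) * τ :=
    fun s h h' => T.height hi h h'
  have hYq := T.height (j := i + 1) (by omega) hq hqc
  have hYq' := hY q hq (hqm.trans hm)
  push_cast at hYq
  obtain ⟨l₁, a, hl₁, haG, ha, hax, hax', hay⟩ : ∃ l₁ a,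
      GreedyDownLeft S {z | z.2 ≤ (post (i + 1) q).2 + τ} p l₁ a ∧
      a.2 ≤ (post (i + 1) q).2 + τ ∧ S.FreeAt a ∧ a.1 ≤ p.1 ∧ (post i q).1 ≤ a.1 ∧
      (post (i + 1) q).2 ≤ a.2 := by
    -- The goal height is the height of `post i q`.
    rcases le_or_gt p.2 ((post (i + 1) q).2 + τ) with hle | hlt
    · exact ⟨_, p, Greedy.done p hle, hle, hp, le_rfl,
        (T.le_right_of_le hi hq hqm hm).trans h1, h3⟩
    -- Consecutive posts of a fence differ in height by `τ`, so their lower halves are stacked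
    -- without gaps. When the robot falls below the lower half of one post, the preceding post,
    -- which is not farther right, takes over as the barrier.
    have down : ∀ x y : ℝ, (post (i + 1) q).2 + τ ≤ y → ∀ s, q ≤ s → s ≤ m →
        (post i s).1 ≤ x → y ≤ (post i s).2 →
        ∃ s, q ≤ s ∧ s ≤ m ∧ (post i s).1 ≤ x ∧ (post i s).2 - τ < y ∧ y ≤ (post i s).2 := by
      intro x y hy s hs
      induction s, hs using Nat.le_induction with
      | base => exact fun hm hx hy' => ⟨q, le_rfl, hm, hx, by nlinarith, hy'⟩
      | succ s hs ih =>
        intro hm' hx hy'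
        have e1 := hY s (by omega) (by omega)
        have e2 := hY (s + 1) (by omega) (by omega)
        push_cast at e2
        rcases lt_or_ge ((post i (s + 1)).2 - τ) y with h | h
        · exact ⟨s + 1, by omega, hm', hx, h, hy'⟩
        · exact ih (by omega) ((T.le_right hi (by omega) (by omega)).trans hx) (by linarith)
    obtain ⟨l, a, hl⟩ := exists_greedyDownLeft S
      (G := {z | z.2 ≤ (post (i + 1) q).2 + τ}) (isClosed_le continuous_snd continuous_const)
      (h := (post (i + 1) q).2 + τ) (fun z hz => hz.le) hp hlt.le
    obtain ⟨ha1, ⟨ha2, s, hs1, hs2, hs3, -⟩, ha3, ha4⟩ := hl.invariant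
      (I := fun z => (post (i + 1) q).2 + τ ≤ z.2 ∧ ∃ s, q ≤ s ∧ s ≤ m ∧ (post i s).1 ≤ z.1 ∧
        (post i s).2 - τ < z.2 ∧ z.2 ≤ (post i s).2) (by
        rintro x y y' ⟨hI, s, hs1, hs2, hs3, hs4, hs5⟩ hlt hG
        simp only at hI hs3 hs4 hs5 ⊢
        have hy' : (post (i + 1) q).2 + τ ≤ y' := by
          by_contra! h
          exact hG _ h hI (le_refl ((post (i + 1) q).2 + τ))
        exact ⟨hy', down x y' hy' s hs1 hs2 hs3 (by linarith)⟩) (by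
        rintro x x' y ⟨hI, s, hs1, hs2, hs3, hs4, hs5⟩ R' hR' hb hx' hxx'
        refine ⟨hI, s, hs1, hs2, ?_, hs4, hs5⟩
        obtain ⟨R, hR, e1, e2, e3⟩ := (T.node i s hi (by omega) (by omega)).2.1
        simp only at hs3 hs4 hs5
        simp only [e1] at hs3 ⊢
        exact left_le_of_blocksDown S hR hR' hb hx' hs3 (by linarith) (by linarith))
      ⟨hlt.le, down p.1 p.2 hlt.le m hqm le_rfl h1 h4⟩ hp
    exact ⟨l, a, hl, ha1, ha3, ha4, (T.le_right_of_le hi hq hs1 (hs2.trans hm)).trans hs3,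
      by linarith⟩
  have hne : (i + 1, q) ≠ (1, 1) := by simp; omega
  obtain ⟨hlast, hmono, -⟩ := T.branch_spec (j := i + 1) (by omega) hq hqc
  obtain ⟨l₂, b, hl₂⟩ := exists_greedyRightDown S hmono (T.post_mem_trace (by omega) hq hqc hne)
    (T.node (i + 1) q (by omega) hq hqc).1.le hτ ha
    (T.mem_aboveTrace hτ hi hq hqc ha hax' (hax.trans h2) hay) (hax.trans h2) haG
  have hb := (Greedy.invariant (I := fun _ => True) (by simp) (by simp) hl₂ trivial).2
  rcases hb with hb | ⟨u, v, ⟨pre, suf, e⟩, hb⟩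
  · exact ⟨_, _, ⟨hqm, h1, h2, h3, h4⟩, l₁, a, l₂, b, _, hl₁, hl₂, Or.inl ⟨hb, rfl⟩, rfl, rfl⟩
  · exact ⟨_, _, ⟨hqm, h1, h2, h3, h4⟩, l₁, a, l₂, b, b :: v :: suf, hl₁, hl₂,
      Or.inr ⟨pre, u, v, suf, by simp [← e], hb, rfl⟩, rfl,
      List.getLast?_eq_some_getLast (by simp)⟩

lemma freeAt (T : FoundTree S τ P₀ cnt post branch walk) (hτ : 0 < τ) {j r : ℕ} (hj : 1 ≤ j)
    (hr : 1 ≤ r) (hc : r ≤ cnt j) : S.FreeAt (post j r) := by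
  obtain ⟨h1, h2, -⟩ := T.node j r hj hr hc
  exact h2.freeAt h1.le (y := (post j r).2) (by linarith) (by linarith)

/-- Each call ends at a post, where the conditions of the next call hold by `le_down` and `height`.
-/
lemma exists_goDownTo_of_post (T : FoundTree S τ P₀ cnt post branch walk) (hτ : 0 < τ) {i m : ℕ}
    (hm : 1 ≤ m) (hc : m ≤ cnt i) (d : ℕ) : ∀ j, 1 ≤ j → j + d = i →
      ∃ l, GoDownTo S τ post branch i m j (post j m) l (post i m) := by
  induction d with
  | zero =>
    rintro j - rfl
    exact ⟨_, GoDownTo.done _⟩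
  | succ d ih =>
    intro j hj h
    have hc1 := T.cnt_anti (j := j) (j' := i) (by omega) (by omega)
    have hc2 := T.cnt_anti (j := j + 1) (j' := i) (by omega) (by omega)
    obtain ⟨l', hl'⟩ := ih (j + 1) (by omega) (by omega)
    have e1 := T.height hj hm (hc.trans hc1)
    have e2 := T.height (j := j + 1) (by omega) hm (hc.trans hc2)
    push_cast at e2
    obtain ⟨l, e, hl⟩ := T.exists_goDown hτ hj hm le_rfl (hc.trans hc1) (hc.trans hc2)
      (T.freeAt hτ hj hm (hc.trans hc1)) le_rfl (T.le_down hj hm (hc.trans hc2)) (by nlinarith)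
      le_rfl
    obtain rfl := hl.end_eq (T.branch_spec (by omega) hm (hc.trans hc2)).1
    exact ⟨_, GoDownTo.call j _ l _ l' _ (by omega) hl hl'⟩

lemma exists_goDownTo (T : FoundTree S τ P₀ cnt post branch walk) (hτ : 0 < τ) {i j m : ℕ}
    (hj : 1 ≤ j) (hji : j < i) (hm : 1 ≤ m) (hc : m ≤ cnt i) {p : Point} (hp : S.FreeAt p)
    (h1 : (post j m).1 ≤ p.1) (h2 : p.1 ≤ (post (j + 1) m).1)
    (h3 : (post (j + 1) m).2 ≤ p.2) (h4 : p.2 ≤ (post j m).2) :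
    ∃ l, GoDownTo S τ post branch i m j p l (post i m) := by
  have hc1 := T.cnt_anti (j := j) (j' := i) (by omega) (by omega)
  have hc2 := T.cnt_anti (j := j + 1) (j' := i) (by omega) (by omega)
  obtain ⟨l', hl'⟩ := T.exists_goDownTo_of_post hτ hm hc (i - (j + 1)) (j + 1) (by omega) (by omega)
  obtain ⟨l, e, hl⟩ := T.exists_goDown hτ hj hm le_rfl (hc.trans hc1) (hc.trans hc2) hp h1 h2 h3 h4
  obtain rfl := hl.end_eq (T.branch_spec (by omega) hm (hc.trans hc2)).1
  exact ⟨_, GoDownTo.call j _ l _ l' _ hji hl hl'⟩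

/-! ### `GoBackDown` -/

/-- The horizontal pieces of the branch to `post i' (m + 1)` that are to the right of
`post i m`. -/
lemma horizontalPiece (T : FoundTree S τ P₀ cnt post branch walk) {i m : ℕ} (hm : 1 ≤ m)
    (hc : m + 1 ≤ cnt i) {i' : ℕ} (hi' : 1 ≤ i') (hii : i' ≤ i) {u v : Point}
    (huv : [u, v] <:+: branch i' (m + 1)) (hlt : u.1 < v.1) (hv : (post i m).1 < v.1) :
    ∃ l, 1 ≤ l ∧ l ≤ i' ∧ (post l m).1 ≤ u.1 ∧
      S.HorizontalPiece τ (P₀.2 + ((m : ℝ) + 1 - l) * τ) u v := by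
  induction i', hi' using Nat.le_induction with
  | base =>
    refine T.edge_cases (C := fun j r => j = 1 → r = m + 1 → [u, v] <:+: branch j r →
      ∃ l, 1 ≤ l ∧ l ≤ 1 ∧ (post l m).1 ≤ u.1 ∧
      S.HorizontalPiece τ (P₀.2 + ((m : ℝ) + 1 - l) * τ) u v) ?_ ?_ le_rfl
      (by omega) (hc.trans (T.cnt_anti le_rfl hii)) (by simp; omega) rfl rfl huv
    · rintro j r l hj hr hc' - hl hb rfl hrm huv
      obtain rfl : r = m := by omega
      rw [hb] at huv
      have hb' := T.branch_spec hj hr (by omega)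
      rcases pair_infix_append huv with h | h | ⟨h1, h2⟩
      -- The branch to `post 1 r` stays at or to the left of this post, hence of `post i m`, while
      -- `v` is beyond; so the piece belongs to the last edge.
      · have h1 := hb'.2.2.2.1 v (h.subset (by simp))
        have h2 := T.le_down_of_le hj hr hii (by omega)
        linarith
      · have := hl.edge_horizontalPiece (T.node _ _ hj (by omega) hc').1 h hlt
        refine ⟨1, le_rfl, le_rfl, this.1, ?_⟩
        convert this.2 using 1
        rw [T.height hj hr (by omega)]
        push_cast
        ring
      -- A branch lists the post between two consecutive edges twice; the piece between the two
      -- copies has length zero.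
      · rw [hb'.1] at h1
        simp only [List.head?_cons, Option.some.injEq] at h1 h2
        rw [← h1, ← h2] at hlt
        exact absurd hlt (lt_irrefl _)
    · intros
      omega
  | succ i' hi' ih =>
    refine T.edge_cases (C := fun j r => j = i' + 1 → r = m + 1 → [u, v] <:+: branch j r →
      ∃ l, 1 ≤ l ∧ l ≤ i' + 1 ∧ (post l m).1 ≤ u.1 ∧
      S.HorizontalPiece τ (P₀.2 + ((m : ℝ) + 1 - l) * τ) u v) ?_ ?_ (j := i' + 1) (by omega)
      (by omega) (hc.trans (T.cnt_anti (by omega) hii)) (by simp; omega) rfl rfl huv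
    · rintro j r l hj hr hc' - hl hb rfl hrm huv
      obtain rfl : r = m := by omega
      rw [hb] at huv
      have hb' := T.branch_spec hj hr (by omega)
      rcases pair_infix_append huv with h | h | ⟨h1, h2⟩
      · have h1 := hb'.2.2.2.1 v (h.subset (by simp))
        have h2 := T.le_down_of_le hj hr hii (by omega)
        linarith
      · have := hl.edge_horizontalPiece (T.node _ _ hj (by omega) hc').1 h hlt
        refine ⟨i' + 1, by omega, le_rfl, this.1, ?_⟩
        convert this.2 using 1
        rw [T.height hj hr (by omega)]
        push_cast
        ring
      · rw [hb'.1] at h1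
        simp only [List.head?_cons, Option.some.injEq] at h1 h2
        rw [← h1, ← h2] at hlt
        exact absurd hlt (lt_irrefl _)
    · rintro j r l hj hr hc' hpar hl hb hji rfl huv
      obtain rfl : j = i' := by omega
      rw [hb] at huv
      have hcj : m + 1 ≤ cnt j := hc'.trans (T.anti j hj)
      have hb' := T.branch_spec hj hr hcj
      rcases pair_infix_append huv with h | h | ⟨h1, h2⟩
      · obtain ⟨l, h1, h2, h3⟩ := ih (by omega) h
        exact ⟨l, h1, by omega, h3⟩
      · have := hl.edge_horizontalPiece (T.node _ _ (by omega) (by omega) hc').1 h hlt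
        refine ⟨j + 1, by omega, le_rfl, ?_, ?_⟩
        -- By the parent rule, a down-edge into the post with number `m + 1` starts to the right of
        -- the post with number `m` on the lower fence.
        · rcases hpar with h | h
          · omega
          · exact h.le.trans this.1
        · convert this.2 using 1
          rw [T.height hj hr hcj]
          push_cast
          ring
      · rw [hb'.1] at h1
        simp only [List.head?_cons, Option.some.injEq] at h1 h2
        rw [← h1, ← h2] at hlt
        exact absurd hlt (lt_irrefl _)

end FoundTree

lemma isClosed_backGoal (post : ℕ → ℕ → Point) (i m : ℕ) (y : ℝ) :
    IsClosed {z : Point | (∃ j, 1 ≤ j ∧ j < i ∧ z ∈ region post m j) ∨ z.2 = y} := by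
  have : {z : Point | (∃ j, 1 ≤ j ∧ j < i ∧ z ∈ region post m j) ∨ z.2 = y} =
      (⋃ j ∈ Set.Ico 1 i, region post m j) ∪ {z | z.2 = y} := by
    ext z
    simp [and_assoc]
  rw [this]
  refine IsClosed.union ((Set.finite_Ico 1 i).isClosed_biUnion fun j _ => ?_)
    (isClosed_eq continuous_snd continuous_const)
  exact isClosed_Icc

lemma mem_region {post : ℕ → ℕ → Point} {m j : ℕ} (h1 : (post j m).1 ≤ (post (j + 1) m).1)
    (h2 : (post (j + 1) m).2 ≤ (post j m).2) {z : Point} : z ∈ region post m j ↔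
      ((post j m).1 ≤ z.1 ∧ z.1 ≤ (post (j + 1) m).1) ∧
      (post (j + 1) m).2 ≤ z.2 ∧ z.2 ≤ (post j m).2 := by
  simp only [region, Set.uIcc, Set.mem_Icc, Prod.le_def, Prod.fst_inf, Prod.snd_inf, Prod.fst_sup,
    Prod.snd_sup, inf_eq_left.2 h1, sup_eq_right.2 h1, inf_eq_right.2 h2, sup_eq_left.2 h2]
  tauto

/-- `GoBackDown` can be carried out. -/
lemma FoundTree.exists_goBackDown {S : Scene} {τ : ℝ} {P₀ : Point} {cnt : ℕ → ℕ}
    {post : ℕ → ℕ → Point} {branch : ℕ → ℕ → List Point} {walk : List Point}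
    (T : FoundTree S τ P₀ cnt post branch walk) (hτ : 0 < τ) {i m q : ℕ} (hi : 1 ≤ i) (hq : 1 ≤ q)
    (hqm : q + 1 ≤ m) (hc : m + 1 ≤ cnt i) (hqc : q ≤ cnt (i + 1))
    (h1 : (post (i + 1) q).1 < (post i (m + 1)).1) (h2 : (post i m).1 ≤ (post (i + 1) q).1) :
    ∃ path e, GoBackDown S τ post branch i (m + 1) q (post i (m + 1)) path e := by
  have hm : 1 ≤ m := by omega
  have hci : ∀ l, 1 ≤ l → l ≤ i → m + 1 ≤ cnt l := fun l h h' => hc.trans (T.cnt_anti h h')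
  have hY : ∀ l, 1 ≤ l → l ≤ i → (post l m).2 = P₀.2 + ((m : ℝ) - l) * τ := fun l h h' =>
    T.height h hm (by have := hci l h h'; omega)
  have hX : ∀ l, 1 ≤ l → l ≤ i → (post l m).1 ≤ (post i m).1 := fun l h h' =>
    T.le_down_of_le h hm h' (by omega)
  have hregion : ∀ l, 1 ≤ l → l < i → ∀ z, z ∈ region post m l ↔
      ((post l m).1 ≤ z.1 ∧ z.1 ≤ (post (l + 1) m).1) ∧
      (post (l + 1) m).2 ≤ z.2 ∧ z.2 ≤ (post l m).2 := by
    intro l h h' z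
    refine mem_region (T.le_down h hm ?_) ?_
    · have := hci (l + 1) (by omega) (by omega)
      omega
    · have e1 := hY l h h'.le
      have e2 := hY (l + 1) (by omega) (by omega)
      push_cast at e2
      linarith
  obtain ⟨hlast, hmono, hroot, hbd, -⟩ := T.branch_spec hi (r := m + 1) (by omega) hc
  obtain ⟨l₁, a, u, v, hl₁, -, huv, hu, hv, ha, hac⟩ :=
    exists_followUntil (L := (branch i (m + 1)).reverse) (c := (post (i + 1) q).1)
      _ (by rw [List.head?_reverse, hlast]) h1 ⟨P₀, by simpa using hroot, by
        rw [← T.root.1]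
        have e := T.le_down_of_le (j := 1) (j' := i + 1) (r := 1) le_rfl le_rfl (by omega)
          (by omega)
        exact e.trans (T.le_right_of_le (by omega) le_rfl hq hqc)⟩
  have hvu : [v, u] <:+: branch i (m + 1) := by
    have := List.reverse_infix.2 huv
    simpa using this
  obtain ⟨l, hl, hli, hlv, hfree, hflat, hpiece⟩ := T.horizontalPiece hm hc hi le_rfl hvu
    (hv.trans_lt hu) (h2.trans_lt hu)
  rw [segment_symm] at ha
  have haf : S.FreeAt a := hfree a ha
  have hay : a.2 = v.2 := snd_eq_of_mem_segment hflat ha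
  have hva : v.1 ≤ a.1 := by linarith
  set G : Set Point := {z | (∃ j, 1 ≤ j ∧ j < i ∧ z ∈ region post m j) ∨ z.2 = (post i m).2}
    with hG
  -- The robot is to the right of the upper half of some `post l m` with `l ≤ i`; these halves are
  -- stacked from the height of `post i m` up to `(post 1 m).2 + τ`. Farther up there is no such
  -- post, and the barrier is the obstacle over which the branch passes where the robot leaves it.
  set I : Point → Prop := fun z => (post i m).2 ≤ z.2 ∧
    ((∃ l, 1 ≤ l ∧ l ≤ i ∧ (post l m).1 ≤ z.1 ∧ (post l m).2 ≤ z.2 ∧ z.2 ≤ (post l m).2 + τ) ∨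
      ∃ R ∈ S.obstacles, (post 1 m).1 ≤ R.left ∧ (R.left : ℝ) ≤ z.1 ∧
        R.bottom < (post 1 m).2 + τ ∧ (post 1 m).2 + τ < z.2 ∧ z.2 ≤ R.top) with hI
  have hIa : I a := by
    have hyl := hY l hl hli
    have hyi := hY i hi le_rfl
    have hli' : (l : ℝ) ≤ i := by exact_mod_cast hli
    -- The piece belongs to an edge at height `(post l m).2 + τ`, from which it deviates by less
    -- than `τ`.
    have hlow : (post l m).2 < v.2 := by
      rcases hpiece with h | ⟨R, -, -, -, -, -, h, -⟩
      · rw [h, hyl]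
        nlinarith
      · have := (abs_lt.1 h).1
        rw [hyl]
        nlinarith
    have hup : v.2 < (post l m).2 + 2 * τ := by
      rcases hpiece with h | ⟨R, -, -, -, -, -, h, -⟩
      · rw [h, hyl]
        nlinarith
      · have := (abs_lt.1 h).2
        rw [hyl]
        nlinarith
    refine ⟨by rw [hay, hyi]; rw [hyl] at hlow; nlinarith, ?_⟩
    rcases le_or_gt a.2 ((post l m).2 + τ) with h | h
    · exact Or.inl ⟨l, hl, hli, by rw [hac]; exact (hX l hl hli).trans h2, by linarith, h⟩
    -- The next upper half is that of `post (l - 1) m`. For `l = 1` the piece is above the height of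
    -- its edge, hence runs along the top of an obstacle.
    rcases hl.eq_or_lt with rfl | hl'
    · right
      rcases hpiece with h' | ⟨R, hR, e1, -, e2, e3, -, e4⟩
      · push_cast at hyl h'
        linarith
      · push_cast at hyl e2 e3
        refine ⟨R, hR, by linarith, by linarith, by linarith, h, ?_⟩
        rcases e4 with e4 | e4 <;> linarith
    · left
      have hyl' := hY (l - 1) (by omega) (by omega)
      rw [Nat.cast_sub hl] at hyl'
      push_cast at hyl'
      refine ⟨l - 1, by omega, by omega, ?_, by linarith, by linarith⟩
      rw [hac]
      exact (hX _ (by omega) (by omega)).trans h2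
  obtain ⟨l₂, b, hl₂⟩ := exists_greedyDownLeft S (isClosed_backGoal post i m (post i m).2)
    (h := (post i m).2) (fun z hz => Or.inr hz) haf hIa.1
  -- When the robot falls past the height of `post l m` without stopping, it is beyond `post (l + 1)
  -- m`, as otherwise it would meet the upper side of the region between these two posts. So the
  -- barrier passes to `post (l + 1) m`.
  have descend : ∀ x y y' : ℝ, (post i m).2 ≤ y' → (∀ w, y' < w → w ≤ y → (x, w) ∉ G) → ∀ d l,
      l + d = i → 1 ≤ l → (post l m).1 ≤ x → (post l m).2 ≤ y → y' ≤ (post l m).2 + τ →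
      ∃ l, 1 ≤ l ∧ l ≤ i ∧ (post l m).1 ≤ x ∧ (post l m).2 ≤ y' ∧ y' ≤ (post l m).2 + τ := by
    intro x y y' hy' hw d
    induction d with
    | zero =>
      rintro l rfl hl hx hy hyτ
      exact ⟨l, hl, le_rfl, hx, hy', hyτ⟩
    | succ d ih =>
      intro l hld hl hx hy hyτ
      rcases le_or_gt (post l m).2 y' with h | h
      · exact ⟨l, hl, by omega, hx, h, hyτ⟩
      have hn := hw _ h hy
      have e1 := hY l hl (by omega)
      have e2 := hY (l + 1) (by omega) (by omega)
      push_cast at e2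
      refine ih (l + 1) (by omega) (by omega) ?_ (by linarith) (by linarith)
      by_contra! hlt
      refine hn (Or.inl ⟨l, hl, by omega, (hregion l hl (by omega) _).2 ⟨⟨hx, hlt.le⟩, ?_, le_rfl⟩⟩)
      show (post (l + 1) m).2 ≤ (post l m).2
      linarith
  obtain ⟨hbG, hIb, hbf, hba⟩ := hl₂.invariant (I := I) (by
      rintro x y y' ⟨hI, hJ⟩ hlt hw
      simp only at hI hJ
      have hy' : (post i m).2 ≤ y' := by
        by_contra! h
        exact hw _ h hI (Or.inr rfl)
      refine ⟨hy', ?_⟩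
      rcases hJ with ⟨l, hl, hli, h1, h2, h3⟩ | ⟨R, hR, h1, h2, h3, h4, h5⟩
      · exact Or.inl (descend x y y' hy' hw (i - l) l (by omega) hl h1 h2 (by linarith))
      · rcases lt_or_ge ((post 1 m).2 + τ) y' with h | h
        · exact Or.inr ⟨R, hR, h1, h2, h3, h, by show y' ≤ _; linarith⟩
        · exact Or.inl (descend x y y' hy' hw (i - 1) 1 (by omega) le_rfl (by linarith)
            (by linarith) h)) (by
      rintro x x' y ⟨hI, hJ⟩ R' hR' hb hx' hxx'
      refine ⟨hI, ?_⟩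
      rcases hJ with ⟨l, hl, hli, h1, h2, h3⟩ | ⟨R, hR, h1, h2, h3, h4, h5⟩
      · refine Or.inl ⟨l, hl, hli, ?_, h2, h3⟩
        obtain ⟨R, hR, e1, e2, e3⟩ := (T.node l m hl hm (by have := hci l hl hli; omega)).2.1
        simp only at h1 h2 h3
        simp only [e1] at h1 ⊢
        exact left_le_of_blocksDown S hR hR' hb hx' h1 (by linarith) (by linarith)
      · exact Or.inr ⟨R, hR, h1, left_le_of_blocksDown S hR hR' hb hx' h2 (h3.trans h4) h5, h3, h4,
          h5⟩) hIa haf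
  have hfinal : ∀ b' : Point, S.FreeAt b' → (post i m).1 ≤ b'.1 → b'.1 ≤ (post (i + 1) q).1 →
      b'.2 = (post i m).2 → ∃ path e, GoDown S τ post branch i m q b' path e := by
    intro b' hb' hx1 hx2 hy
    refine T.exists_goDown hτ hi hq (by omega) (by omega) hqc hb' hx1 hx2 ?_ hy.le
    rw [hy, T.height (j := i + 1) (by omega) hq hqc, hY i hi le_rfl]
    have : (q : ℝ) ≤ m := by exact_mod_cast (by omega : q ≤ m)
    push_cast
    nlinarith
  by_cases hreg : ∃ j, 1 ≤ j ∧ j < i ∧ b ∈ region post m j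
  · obtain ⟨j, hj, hji, hbj⟩ := hreg
    obtain ⟨⟨r1, r2⟩, r3, r4⟩ := (hregion j hj hji b).1 hbj
    obtain ⟨l₃, hl₃⟩ := T.exists_goDownTo hτ hj hji hm (by omega) hbf r1 r2 r3 r4
    obtain ⟨l₄, e, hl₄⟩ := hfinal (post i m) (T.freeAt hτ hi hm (by omega)) le_rfl h2 rfl
    exact ⟨_, e, ⟨rfl, by omega, h1, h2⟩, l₁, a, l₂, b, l₃, post i m, l₄, hl₁, hl₂,
      Or.inl ⟨j, hj, hji, hbj, hl₃⟩, hl₄, rfl⟩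
  · have hby : b.2 = (post i m).2 := hbG.resolve_left hreg
    push Not at hreg
    -- At the height of `post i m`, only `l = i` is left of the alternatives in the invariant.
    have hbx : (post i m).1 ≤ b.1 := by
      have hyi := hY i hi le_rfl
      rcases hIb.2 with ⟨l, hl, hli, g1, g2, g3⟩ | ⟨R, hR, -, -, -, g, -⟩
      · rcases hli.eq_or_lt with rfl | hlt
        · exact g1
        · have hyl := hY l hl hli
          have : (l : ℝ) + 1 ≤ i := by exact_mod_cast hlt
          rw [hby, hyi, hyl] at g2
          nlinarith
      · have hy1 := hY 1 le_rfl hi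
        have : (1 : ℝ) ≤ i := by exact_mod_cast hi
        rw [hby, hyi, hy1] at g
        push_cast at g
        nlinarith
    obtain ⟨l₄, e, hl₄⟩ := hfinal b hbf hbx (by linarith) hby
    exact ⟨_, e, ⟨rfl, by omega, h1, h2⟩, l₁, a, l₂, b, [], b, l₄, hl₁, hl₂,
      Or.inr ⟨hreg, rfl, rfl⟩, hl₄, rfl⟩

/-! ### Uniqueness of the fence-tree -/

lemma UpEdge.unique {S : Scene} {τ : ℝ} {P P₁ P₂ : Point} {l₁ l₂ : List Point}
    (h₁ : UpEdge S τ P l₁ P₁) (h₂ : UpEdge S τ P l₂ P₂) (hn₁ : P₁.1 < S.n) (hn₂ : P₂.1 < S.n) :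
    P₁ = P₂ := by
  obtain ⟨_, h₁, -⟩ := h₁
  obtain ⟨_, h₂, -⟩ := h₂
  exact h₁.end_unique h₂ hn₁ hn₂

lemma DownEdge.unique {S : Scene} {τ : ℝ} {P P₁ P₂ : Point} {l₁ l₂ : List Point}
    (h₁ : DownEdge S τ P l₁ P₁) (h₂ : DownEdge S τ P l₂ P₂) (hn₁ : P₁.1 < S.n)
    (hn₂ : P₂.1 < S.n) : P₁ = P₂ := by
  obtain ⟨_, h₁, -⟩ := h₁
  obtain ⟨_, h₂, -⟩ := h₂
  exact h₁.end_unique h₂ hn₁ hn₂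

/-- Both trees agree on the two candidates for the parent of a node, the abscissas of these decide
between them, and the start of a `τ`-path determines its end. -/
lemma IsFenceTree.unique {S : Scene} {τ : ℝ} {k M : ℕ} {P₀ : Point} {P P' : ℕ → ℕ → Point}
    (h : IsFenceTree S τ k M P₀ P) (h' : IsFenceTree S τ k M P₀ P') {i m : ℕ}
    (hi : i ∈ Finset.Icc 1 k) (hm : m ∈ Finset.Icc 1 M) : P' i m = P i m := by
  obtain ⟨N, hN⟩ : ∃ N, i + m = N := ⟨_, rfl⟩
  induction N using Nat.strong_induction_on generalizing i m with
  | _ N ih =>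
    by_cases hne : (i, m) = (1, 1)
    · cases hne
      rw [h.1, h'.1]
    have hn := (h.2.1 i hi m hm).1
    have hn' := (h'.2.1 i hi m hm).1
    obtain ⟨path, hp⟩ := h.2.2 i hi m hm hne
    obtain ⟨path', hp'⟩ := h'.2.2 i hi m hm hne
    rw [Finset.mem_Icc] at hi hm
    have hup : i ≠ 1 → P' (i - 1) m = P (i - 1) m := fun h1 =>
      ih (i - 1 + m) (by omega) (Finset.mem_Icc.2 ⟨by omega, by omega⟩) (Finset.mem_Icc.2 hm) rfl
    have hleft : m ≠ 1 → P' i (m - 1) = P i (m - 1) := fun h1 =>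
      ih (i + (m - 1)) (by omega) (Finset.mem_Icc.2 hi) (Finset.mem_Icc.2 ⟨by omega, by omega⟩) rfl
    by_cases h1 : i = 1
    · subst h1
      have hm1 : m ≠ 1 := by rintro rfl; exact hne rfl
      rcases hp with ⟨-, hp⟩ | ⟨h, -⟩ | ⟨h, -⟩ | ⟨h, -⟩ <;> try exact absurd rfl h
      rcases hp' with ⟨-, hp'⟩ | ⟨h, -⟩ | ⟨h, -⟩ | ⟨h, -⟩ <;> try exact absurd rfl h
      rw [hleft hm1] at hp'
      exact hp'.unique hp hn' hn
    by_cases h2 : m = 1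
    · subst h2
      rcases hp with ⟨h, -⟩ | ⟨-, -, hp⟩ | ⟨-, h, -⟩ | ⟨-, h, -⟩ <;> try exact absurd rfl h
      · exact absurd h h1
      rcases hp' with ⟨h, -⟩ | ⟨-, -, hp'⟩ | ⟨-, h, -⟩ | ⟨-, h, -⟩ <;> try exact absurd rfl h
      · exact absurd h h1
      rw [hup h1] at hp'
      exact hp'.unique hp hn' hn
    simp only [EdgeInto, h1, h2, hup h1, hleft h2, ne_eq, not_false_eq_true, true_and,
      false_and, false_or] at hp hp'
    rcases hp with ⟨a, hp⟩ | ⟨a, hp⟩ <;> rcases hp' with ⟨b, hp'⟩ | ⟨b, hp'⟩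
    · exact hp'.unique hp hn' hn
    · linarith
    · linarith
    · exact hp'.unique hp hn' hn

/-! ### Extending the tree that has been found -/

namespace FoundTree

variable {S : Scene} {τ : ℝ} {P₀ : Point} {cnt : ℕ → ℕ} {post : ℕ → ℕ → Point}
  {branch : ℕ → ℕ → List Point} {walk : List Point}

lemma append_walk (T : FoundTree S τ P₀ cnt post branch walk) (w : List Point) :
    FoundTree S τ P₀ cnt post branch (walk ++ w) where
  root := T.root
  anti := T.anti
  node j r hj hr hc := by
    obtain ⟨a, b, c, d⟩ := T.node j r hj hr hc
    exact ⟨a, b, c, List.mem_append_left _ d⟩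
  edge j r hj hr hc hne := by
    obtain ⟨path, h, h'⟩ := T.edge j r hj hr hc hne
    exact ⟨path, h.trans (List.prefix_append _ _).isInfix, h'⟩

/-- The new post is added at a corner of the staircase, so it is neither an old post nor a candidate
for the parent of one. -/
lemma extend (T : FoundTree S τ P₀ cnt post branch walk) {j : ℕ} (hj : 1 ≤ j)
    (hne : (j, cnt j + 1) ≠ (1, 1)) (hanti : j = 1 ∨ cnt j + 1 ≤ cnt (j - 1))
    {path br : List Point} {p : Point} (hp : p.1 < S.n) (hpost : S.IsPost τ p)
    (hheight : p.2 = P₀.2 + (((cnt j + 1 : ℕ) : ℝ) - j) * τ) (hlast : path.getLast? = some p)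
    (hedge : (2 ≤ cnt j + 1 ∧ (j = 1 ∨ (post (j - 1) (cnt j + 1)).1 ≤ (post j (cnt j)).1) ∧
      UpEdge S τ (post j (cnt j)) path p ∧ br = branch j (cnt j) ++ path) ∨
    (2 ≤ j ∧ (cnt j + 1 = 1 ∨ (post j (cnt j)).1 < (post (j - 1) (cnt j + 1)).1) ∧
      DownEdge S τ (post (j - 1) (cnt j + 1)) path p ∧
      br = branch (j - 1) (cnt j + 1) ++ path)) :
    FoundTree S τ P₀ (Function.update cnt j (cnt j + 1))
      (Function.update post j (Function.update (post j) (cnt j + 1) p))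
      (Function.update branch j (Function.update (branch j) (cnt j + 1) br)) (walk ++ path) := by
  set cnt' := Function.update cnt j (cnt j + 1) with hcnt'
  set post' := Function.update post j (Function.update (post j) (cnt j + 1) p) with hpost'
  set branch' := Function.update branch j (Function.update (branch j) (cnt j + 1) br) with hbranch'
  have post_old : ∀ a b, ¬ (a = j ∧ b = cnt j + 1) → post' a b = post a b := by
    intro a b h
    by_cases ha : a = j
    · subst ha
      simp [hpost', Function.update_of_ne (fun hb => h ⟨rfl, hb⟩ : b ≠ cnt a + 1)]
    · simp [hpost', Function.update_of_ne ha]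
  have branch_old : ∀ a b, ¬ (a = j ∧ b = cnt j + 1) → branch' a b = branch a b := by
    intro a b h
    by_cases ha : a = j
    · subst ha
      simp [hbranch', Function.update_of_ne (fun hb => h ⟨rfl, hb⟩ : b ≠ cnt a + 1)]
    · simp [hbranch', Function.update_of_ne ha]
  have post_new : post' j (cnt j + 1) = p := by simp [hpost']
  have branch_new : branch' j (cnt j + 1) = br := by simp [hbranch']
  have cnt_new : cnt' j = cnt j + 1 := by simp [hcnt']
  have cnt_old : ∀ a, a ≠ j → cnt' a = cnt a := fun a h => by simp [hcnt', Function.update_of_ne h]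
  have cases' : ∀ a b, b ≤ cnt' a → (a = j ∧ b = cnt j + 1) ∨ b ≤ cnt a := by
    intro a b h
    by_cases ha : a = j
    · subst ha
      rw [cnt_new] at h
      omega
    · rw [cnt_old a ha] at h
      exact Or.inr h
  have hne11 : ¬ (1 = j ∧ 1 = cnt j + 1) := by
    rintro ⟨h1, h2⟩
    exact hne (by rw [← h2, ← h1])
  refine ⟨?_, ?_, ?_, ?_⟩
  · rw [post_old _ _ hne11, branch_old _ _ hne11]
    exact T.root
  · intro a ha
    have := T.anti a ha
    by_cases h1 : a = j
    · subst h1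
      rw [cnt_new, cnt_old _ (by omega)]
      omega
    · rw [cnt_old a h1]
      by_cases h2 : a + 1 = j
      · rw [h2, cnt_new]
        rcases hanti with h | h
        · omega
        · rwa [← h2, Nat.add_sub_cancel, h2] at h
      · rwa [cnt_old _ h2]
  · intro a b ha hb hc
    rcases cases' a b hc with ⟨rfl, rfl⟩ | h
    · rw [post_new]
      exact ⟨hp, hpost, hheight, List.mem_append_right _ (List.mem_of_getLast? hlast)⟩
    · have hold : ¬ (a = j ∧ b = cnt j + 1) := by
        rintro ⟨rfl, rfl⟩
        omega
      obtain ⟨h1, h2, h3, h4⟩ := T.node a b ha hb h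
      rw [post_old a b hold]
      exact ⟨h1, h2, h3, List.mem_append_left _ h4⟩
  · intro a b ha hb hc hne'
    rcases cases' a b hc with ⟨rfl, rfl⟩ | h
    · refine ⟨path, (List.suffix_append _ _).isInfix, ?_⟩
      rw [post_new, branch_new, Nat.add_sub_cancel, post_old a (cnt a) (by omega),
        post_old (a - 1) (cnt a + 1) (by omega), branch_old a (cnt a) (by omega),
        branch_old (a - 1) (cnt a + 1) (by omega)]
      exact hedge
    · obtain ⟨path', h1, h2⟩ := T.edge a b ha hb h hne'
      refine ⟨path', h1.trans (List.prefix_append _ _).isInfix, ?_⟩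
      have n1 : ¬ (a = j ∧ b = cnt j + 1) := by
        rintro ⟨rfl, rfl⟩
        omega
      have n2 : ¬ (a = j ∧ b - 1 = cnt j + 1) := by
        rintro ⟨rfl, h⟩
        omega
      -- If the new post were just above an old one, then the old fence would have had more posts
      -- than the fence above it.
      have n3 : ¬ (a - 1 = j ∧ b = cnt j + 1) := by
        rintro ⟨rfl, rfl⟩
        have := T.anti (a - 1) (by omega)
        rw [Nat.sub_add_cancel ha] at this
        omega
      rw [post_old _ _ n1, post_old _ _ n2, post_old _ _ n3, branch_old _ _ n1, branch_old _ _ n2,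
        branch_old _ _ n3]
      exact h2

lemma root_fst_le (T : FoundTree S τ P₀ cnt post branch walk) {j r : ℕ} (hj : 1 ≤ j) (hr : 1 ≤ r)
    (hc : r ≤ cnt j) : P₀.1 ≤ (post j r).1 := by
  rw [← T.root.1]
  exact (T.le_down_of_le le_rfl le_rfl hj (hr.trans hc)).trans (T.le_right_of_le hj le_rfl hr hc)

end FoundTree

/-! ### The invariant of the procedure -/

namespace State

/-- What holds at any time before the robot reaches the wall. -/
structure Inv (S : Scene) (τ : ℝ) (k M : ℕ) (P₀ : Point) (σ : State) : Prop where
  tree : FoundTree S τ P₀ σ.M σ.post σ.branch σ.walk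
  one_le_i : 1 ≤ σ.i
  i_le : σ.i ≤ k
  le_M : σ.M 1 ≤ M
  one_le_cnt : 1 ≤ σ.M σ.i
  X_eq : ∀ j, 1 ≤ j → 1 ≤ σ.M j → σ.X j = (σ.post j (σ.M j)).1
  -- All posts have positive abscissas, so a fence with a post is ahead of an empty next fence.
  X_zero : ∀ j, 1 ≤ j → σ.M j = 0 → σ.X j = 0
  -- Ensures that `GoBackDown` is only called when the next lower fence has a post.
  start : ∀ j, 1 ≤ j → j < k → σ.M (j + 1) = 0 → σ.M j ≤ 1
  pos_eq : σ.pos = σ.post σ.i (σ.M σ.i)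
  -- Excludes `Case2` right after a descent, so that the lower fence is extended there.
  order : ∀ j, σ.i < j → j < k → σ.X j ≤ σ.X (j + 1)
  -- A condition of `GoBackDown`; it also settles the parent rule when the lower fence is at least
  -- two posts behind.
  prev : ∀ j, 1 ≤ j → j < k → 2 ≤ σ.M j → (σ.post j (σ.M j - 1)).1 ≤ σ.X (j + 1)
  -- Prevents a return from a complete fence: there, the robot can go down or halt.
  unfinished : σ.i < k → σ.M (σ.i + 1) < M
  trail_head : ∀ j, 2 ≤ j → j ≤ σ.i → (σ.trail j).head? = some (σ.post (j - 1) (σ.M (j - 1)))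

lemma inv_init {S : Scene} {τ : ℝ} {k M : ℕ} (hk : 1 ≤ k) (hM : 1 ≤ M) {P₀ : Point}
    (hpost : S.IsPost τ P₀) (hwall : P₀.1 < S.n) : Inv S τ k M P₀ (init P₀) := by
  have hcnt : ∀ j r, 1 ≤ j → 1 ≤ r → r ≤ (init P₀).M j → j = 1 ∧ r = 1 := by
    intro j r hj hr hc
    simp only [init] at hc
    split_ifs at hc <;> omega
  refine ⟨⟨⟨rfl, rfl⟩, ?_, ?_, ?_⟩, le_rfl, hk, ?_, ?_, ?_, ?_, ?_, rfl, ?_, ?_, ?_, ?_⟩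
  · intro j hj
    simp only [init]
    rw [if_neg (by omega)]
    omega
  · intro j r hj hr hc
    obtain ⟨rfl, rfl⟩ := hcnt j r hj hr hc
    simp [init, hpost, hwall]
  · intro j r hj hr hc hne
    obtain ⟨rfl, rfl⟩ := hcnt j r hj hr hc
    exact absurd rfl hne
  · simpa [init] using hM
  · simp [init]
  · intro j hj hc
    obtain ⟨rfl, -⟩ := hcnt j _ hj le_rfl hc
    simp [init]
  · intro j hj hc
    simp only [init] at hc ⊢
    split_ifs at hc ⊢
    rfl
  · intro j hj _ _
    simp only [init]
    split_ifs <;> omega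
  · intro j hj _
    simp only [init] at hj ⊢
    rw [if_neg (by omega), if_neg (by omega)]
  · intro j hj _ hc
    obtain ⟨-, h⟩ := hcnt j _ hj (by omega) hc
    omega
  · intro _
    simp only [init]
    rw [if_neg (by omega)]
    omega
  · intro j h1 h2
    simp only [init] at h2
    omega

namespace Inv

variable {S : Scene} {τ : ℝ} {k M : ℕ} {P₀ : Point} {σ : State}

lemma cnt_le (h : Inv S τ k M P₀ σ) {j : ℕ} (hj : 1 ≤ j) : σ.M j ≤ M :=
  (h.tree.cnt_anti le_rfl hj).trans h.le_M

lemma X_pos (h : Inv S τ k M P₀ σ) (hpos : 0 < P₀.1) {j : ℕ} (hj : 1 ≤ j) (hc : 1 ≤ σ.M j) :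
    0 < σ.X j := by
  rw [h.X_eq j hj hc]
  exact hpos.trans_le (h.tree.root_fst_le hj hc le_rfl)

/-- Where a fence is not ahead of the next one, the next one has a post. -/
lemma one_le_of_X_le (h : Inv S τ k M P₀ σ) (hpos : 0 < P₀.1) {j : ℕ} (hj : 1 ≤ j)
    (hc : 1 ≤ σ.M j) (hX : σ.X j ≤ σ.X (j + 1)) : 1 ≤ σ.M (j + 1) := by
  by_contra! h0
  rw [h.X_zero (j + 1) (by omega) (by omega)] at hX
  exact absurd (h.X_pos hpos hj hc) (by linarith)

lemma freeAt_pos (h : Inv S τ k M P₀ σ) {y : ℝ} (h1 : σ.pos.2 - τ ≤ y) (h2 : y ≤ σ.pos.2 + τ) :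
    S.FreeAt (σ.pos.1, y) := by
  obtain ⟨a, b, -⟩ := h.tree.node σ.i _ h.one_le_i h.one_le_cnt le_rfl
  rw [h.pos_eq] at h1 h2 ⊢
  exact b.freeAt a.le h1 h2

lemma exists_upEdge (h : Inv S τ k M P₀ σ) (hτ : 0 < τ) :
    ∃ path p, UpEdge S τ σ.pos path p := by
  obtain ⟨N, hN⟩ := exists_nat_ge (S.n - σ.pos.1)
  obtain ⟨l, e, hl⟩ := S.exists_tauPath (τ := τ) N (σ.pos.1, σ.pos.2 + τ)
    (h.freeAt_pos (by linarith) le_rfl) hN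
  exact ⟨_, e, l, hl, rfl⟩

lemma exists_downEdge (h : Inv S τ k M P₀ σ) (hτ : 0 < τ) :
    ∃ path p, DownEdge S τ σ.pos path p := by
  obtain ⟨N, hN⟩ := exists_nat_ge (S.n - σ.pos.1)
  obtain ⟨l, e, hl⟩ := S.exists_tauPath (τ := τ) N (σ.pos.1, σ.pos.2 - τ)
    (h.freeAt_pos le_rfl (by linarith)) hN
  exact ⟨_, e, l, hl, rfl⟩

/-- In the first case, the next lower fence has a post. -/
lemma one_le_of_case1 (h : Inv S τ k M P₀ σ) (h1 : Case1 k σ) : 1 ≤ σ.M (σ.i + 1) := by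
  by_contra! h0
  have := h.start σ.i h.one_le_i h1.1 (by omega)
  have := h1.2.2
  omega

/-- In the second case, the next lower fence lacks exactly one post. -/
lemma cnt_of_case2 (h : Inv S τ k M P₀ σ) (h1 : ¬ Case1 k σ) (h2 : Case2 k σ) :
    σ.M σ.i = σ.M (σ.i + 1) + 1 := by
  have hle := h.tree.anti σ.i h.one_le_i
  have hle' : σ.M σ.i ≤ σ.M (σ.i + 1) + 1 := by
    by_contra! hlt
    exact h1 ⟨h2.1, h2.2, hlt⟩
  -- With equally many posts on both fences, `le_down` forbids the upper one to be ahead.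
  rcases hle.eq_or_lt with heq | hlt
  · have h3 := h2.2
    have := h.one_le_cnt
    rw [h.X_eq σ.i h.one_le_i h.one_le_cnt, h.X_eq (σ.i + 1) (by omega) (by omega), heq] at h3
    exact absurd (h.tree.le_down h.one_le_i h.one_le_cnt heq.ge) (by linarith)
  · omega

lemma X_le_of_not_case2 (h2 : ¬ Case2 k σ) (hi : σ.i < k) : σ.X σ.i ≤ σ.X (σ.i + 1) := by
  by_contra! hlt
  exact h2 ⟨hi, hlt⟩

lemma exists_goBackDown (h : Inv S τ k M P₀ σ) (hτ : 0 < τ) (h1 : Case1 k σ) :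
    ∃ path p, GoBackDown S τ σ.post σ.branch σ.i (σ.M σ.i) (σ.M (σ.i + 1)) σ.pos path p := by
  have hq := h.one_le_of_case1 h1
  obtain ⟨hi, hX, hc⟩ := h1
  obtain ⟨m, hm⟩ : ∃ m, σ.M σ.i = m + 1 := ⟨σ.M σ.i - 1, by omega⟩
  have hprev := h.prev σ.i h.one_le_i hi (by omega)
  have e1 := h.X_eq σ.i h.one_le_i h.one_le_cnt
  have e2 := h.X_eq (σ.i + 1) (by omega) hq
  have := h.tree.exists_goBackDown hτ (m := m) h.one_le_i hq (by omega) hm.ge le_rfl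
    (by rw [← e2, ← hm, ← e1]; exact hX) (by rw [← e2]; rwa [hm] at hprev)
  rwa [← hm, ← h.pos_eq] at this

lemma exists_goDown (h : Inv S τ k M P₀ σ) (hτ : 0 < τ) (hpos : 0 < P₀.1) (h2 : ¬ Case2 k σ)
    (h4 : Case4 k M σ) :
    ∃ path p, GoDown S τ σ.post σ.branch σ.i (σ.M σ.i) (σ.M (σ.i + 1)) σ.pos path p := by
  obtain ⟨hi, hc, -⟩ := h4
  have hX := X_le_of_not_case2 h2 hi
  have hq := h.one_le_of_X_le hpos h.one_le_i h.one_le_cnt hX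
  have e1 := h.X_eq σ.i h.one_le_i h.one_le_cnt
  have e2 := h.X_eq (σ.i + 1) (by omega) hq
  rw [h.pos_eq]
  refine h.tree.exists_goDown hτ h.one_le_i hq hc.le le_rfl le_rfl
    (h.tree.freeAt hτ h.one_le_i h.one_le_cnt le_rfl) le_rfl (by rwa [← e1, ← e2]) ?_ le_rfl
  rw [h.tree.height h.one_le_i h.one_le_cnt le_rfl, h.tree.height (by omega) hq le_rfl]
  have : (σ.M (σ.i + 1) : ℝ) ≤ σ.M σ.i := by exact_mod_cast hc.le
  push_cast
  nlinarith

/-- The current fence is not completed when the robot returns to the next higher one. -/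
lemma lt_of_not_case5 (h : Inv S τ k M P₀ σ) (h4 : ¬ Case4 k M σ) (h5 : ¬ Case5 k M σ) :
    σ.M σ.i < M := by
  refine lt_of_le_of_ne (h.cnt_le h.one_le_i) fun heq => ?_
  rcases h.i_le.eq_or_lt with hi | hi
  · exact h5 ⟨hi, heq⟩
  · have := h.unfinished hi
    exact h4 ⟨hi, by omega, Or.inl heq⟩

/-- No run gets stuck. -/
lemma exists_step (h : Inv S τ k M P₀ σ) (hτ : 0 < τ) (hpos : 0 < P₀.1)
    (hh : σ.halted = false) : ∃ σ', Step S τ k M σ σ' := by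
  by_cases h1 : Case1 k σ
  · obtain ⟨path, p, hp⟩ := h.exists_goBackDown hτ h1
    exact ⟨_, Step.case1 σ path p hh h1 hp⟩
  by_cases h2 : Case2 k σ
  · obtain ⟨path, p, hp⟩ := h.exists_downEdge hτ
    by_cases hn : p.1 = S.n
    · exact ⟨_, Step.case2Wall σ path p hh h1 h2 hp hn⟩
    · exact ⟨_, Step.case2 σ path p hh h1 h2 hp hn⟩
  by_cases h3 : Case3 M σ
  · obtain ⟨path, p, hp⟩ := h.exists_upEdge hτ
    by_cases hn : p.1 = S.n
    · exact ⟨_, Step.case3Wall σ path p hh h1 h2 h3 hp hn⟩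
    · exact ⟨_, Step.case3 σ path p hh h1 h2 h3 hp hn⟩
  by_cases h4 : Case4 k M σ
  · obtain ⟨path, p, hp⟩ := h.exists_goDown hτ hpos h2 h4
    exact ⟨_, Step.case4 σ path p hh h1 h2 h3 h4 hp⟩
  by_cases h5 : Case5 k M σ
  · exact ⟨_, Step.case5 σ hh h1 h2 h3 h4 h5⟩
  -- An incomplete first fence falls under `Case3`, so there is a higher fence to return to.
  have hi : 1 < σ.i := by
    refine lt_of_le_of_ne h.one_le_i fun heq => h3 (Or.inl ⟨heq.symm, ?_⟩)
    exact h.lt_of_not_case5 h4 h5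
  exact ⟨_, Step.case6 σ _ hh h1 h2 h3 h4 h5 hi (h.trail_head σ.i hi le_rfl)⟩

/-! ### The invariant is preserved -/

/-- Common to `Case2` and `Case3`. Since the last post of fence `j` becomes the last but one, `hX`
for the old state turns into `prev` for the new one. -/
lemma addPost (h : Inv S τ k M P₀ σ) (hpos : 0 < P₀.1) {j : ℕ} (hij : σ.i ≤ j)
    (hji : j ≤ σ.i + 1) (hjk : j ≤ k) (hanti : j = 1 ∨ σ.M j + 1 ≤ σ.M (j - 1))
    (hM : σ.M 1 < M ∨ j ≠ 1) (hX : j < k → σ.X j ≤ σ.X (j + 1))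
    (hunf : j < k → σ.M (j + 1) < M) {path t : List Point} {p : Point} (hp : p.1 < S.n)
    (hpost : S.IsPost τ p) (hheight : p.2 = P₀.2 + (((σ.M j + 1 : ℕ) : ℝ) - j) * τ)
    (hlast : path.getLast? = some p)
    (ht : 2 ≤ j → t.head? = some (σ.post (j - 1) (σ.M (j - 1))))
    (hedge : (2 ≤ σ.M j + 1 ∧
        (j = 1 ∨ (σ.post (j - 1) (σ.M j + 1)).1 ≤ (σ.post j (σ.M j)).1) ∧
        UpEdge S τ (σ.post j (σ.M j)) path p ∧
        σ.branch σ.i (σ.M σ.i) ++ path = σ.branch j (σ.M j) ++ path) ∨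
      (2 ≤ j ∧ (σ.M j + 1 = 1 ∨ (σ.post j (σ.M j)).1 < (σ.post (j - 1) (σ.M j + 1)).1) ∧
        DownEdge S τ (σ.post (j - 1) (σ.M j + 1)) path p ∧
        σ.branch σ.i (σ.M σ.i) ++ path = σ.branch (j - 1) (σ.M j + 1) ++ path)) :
    Inv S τ k M P₀ (σ.addPost j path p t) := by
  have hj : 1 ≤ j := h.one_le_i.trans hij
  have h1 : 1 ≤ σ.M 1 := h.one_le_cnt.trans (h.tree.cnt_anti le_rfl h.one_le_i)
  have hne : (j, σ.M j + 1) ≠ (1, 1) := by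
    intro heq
    rw [Prod.mk.injEq] at heq
    obtain ⟨rfl, h2⟩ := heq
    omega
  have T' := h.tree.extend hj hne hanti hp hpost hheight hlast hedge
  have cnt_old : ∀ a, a ≠ j → (σ.addPost j path p t).M a = σ.M a := fun a ha =>
    Function.update_of_ne ha _ _
  have cnt_new : (σ.addPost j path p t).M j = σ.M j + 1 := Function.update_self _ _ _
  have X_old : ∀ a, a ≠ j → (σ.addPost j path p t).X a = σ.X a := fun a ha =>
    Function.update_of_ne ha _ _
  have X_new : (σ.addPost j path p t).X j = p.1 := Function.update_self _ _ _
  have post_old : ∀ a b, a ≠ j ∨ b ≠ σ.M j + 1 → (σ.addPost j path p t).post a b = σ.post a b := by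
    intro a b hab
    by_cases ha : a = j
    · subst ha
      simp [State.addPost, Function.update_of_ne (hab.resolve_left (by simp))]
    · simp [State.addPost, Function.update_of_ne ha]
  have post_new : (σ.addPost j path p t).post j (σ.M j + 1) = p := by simp [State.addPost]
  have hXp : 1 ≤ σ.M j → σ.X j ≤ p.1 := by
    intro hc
    have := T'.le_right (j := j) (r := σ.M j) hj hc (by simp)
    rw [h.X_eq j hj hc]
    simpa using this
  refine ⟨T', hj, hjk, ?_, ?_, ?_, ?_, ?_, ?_, ?_, ?_, ?_, ?_⟩
  · by_cases hj1 : 1 = j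
    · subst hj1
      rw [cnt_new]
      exact hM.resolve_right (by simp)
    · rw [cnt_old 1 hj1]
      exact h.le_M
  · show 1 ≤ (σ.addPost j path p t).M j
    rw [cnt_new]
    omega
  · intro a ha hc
    by_cases haj : a = j
    · subst haj
      rw [X_new, cnt_new, post_new]
    · rw [cnt_old a haj] at hc ⊢
      rw [X_old a haj, post_old a _ (Or.inl haj)]
      exact h.X_eq a ha hc
  · intro a ha hc
    by_cases haj : a = j
    · subst haj
      rw [cnt_new] at hc
      omega
    · rw [cnt_old a haj] at hc
      rw [X_old a haj]
      exact h.X_zero a ha hc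
  · intro a ha hak hc
    by_cases haj : a = j
    · subst haj
      rw [cnt_old _ (by omega)] at hc
      rw [cnt_new]
      -- If fence `a` had a post before, then `hX` gives the next fence a post too, because an empty
      -- one has abscissa `0`.
      by_contra! hlt
      have := h.one_le_of_X_le hpos ha (by omega) (hX hak)
      omega
    · rw [cnt_old a haj]
      by_cases haj' : a + 1 = j
      · rw [haj', cnt_new] at hc
        omega
      · rw [cnt_old _ haj'] at hc
        exact h.start a ha hak hc
  · show p = (σ.addPost j path p t).post j ((σ.addPost j path p t).M j)
    rw [cnt_new, post_new]
  · intro a ha hak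
    have ha' : j < a := ha
    rw [X_old a (by omega), X_old (a + 1) (by omega)]
    exact h.order a (by omega) hak
  · intro a ha hak hc
    by_cases haj : a = j
    · subst haj
      rw [cnt_new] at hc ⊢
      rw [Nat.add_sub_cancel, post_old _ _ (Or.inr (by omega)), X_old _ (by omega),
        ← h.X_eq a ha (by omega)]
      exact hX hak
    · rw [cnt_old a haj] at hc ⊢
      rw [post_old _ _ (Or.inl haj)]
      have hp := h.prev a ha hak hc
      by_cases haj' : a + 1 = j
      · rw [haj'] at hp ⊢
        rw [X_new]
        refine hp.trans (hXp ?_)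
        by_contra! h0
        have := h.start a ha hak (by rw [haj']; omega)
        omega
      · rwa [X_old _ haj']
  · intro hjk'
    have hjk'' : j < k := hjk'
    show (σ.addPost j path p t).M (j + 1) < M
    rw [cnt_old _ (by omega)]
    exact hunf hjk''
  · intro a ha haj
    have haj' : a ≤ j := haj
    rw [cnt_old _ (by omega), post_old _ _ (Or.inl (by omega))]
    by_cases haj : a = j
    · subst haj
      simp only [State.addPost, Function.update_self]
      exact ht ha
    · simp only [State.addPost, Function.update_of_ne haj]
      exact h.trail_head a ha (by omega)

lemma goDown (h : Inv S τ k M P₀ σ) (hi : σ.i < k) (hc : 1 ≤ σ.M (σ.i + 1)) {path : List Point}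
    {p : Point} (hp : p = σ.post (σ.i + 1) (σ.M (σ.i + 1))) (hhead : path.head? = some σ.pos) :
    Inv S τ k M P₀ (σ.goDown path p) := by
  refine ⟨h.tree.append_walk path, by simp [State.goDown], hi, h.le_M, hc, h.X_eq, h.X_zero,
    h.start, hp, ?_, h.prev, ?_, ?_⟩
  · intro j hj hjk
    exact h.order j (lt_trans (Nat.lt_succ_self _) hj) hjk
  · intro _
    exact (h.tree.anti (σ.i + 1) (by omega)).trans_lt (h.unfinished hi)
  · intro j hj hji
    have hji' : j ≤ σ.i + 1 := hji
    simp only [State.goDown]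
    by_cases hj' : j = σ.i + 1
    · subst hj'
      rw [Function.update_self, hhead, h.pos_eq]
      simp
    · rw [Function.update_of_ne hj']
      exact h.trail_head j hj (by omega)

lemma goUp (h : Inv S τ k M P₀ σ) (h2 : ¬ Case2 k σ) (h4 : ¬ Case4 k M σ) (h5 : ¬ Case5 k M σ)
    (hi : 1 < σ.i) {p : Point} (hp : (σ.trail σ.i).head? = some p) :
    Inv S τ k M P₀ (σ.goUp p) := by
  have hle := h.i_le
  refine ⟨h.tree.append_walk _, ?_, ?_, h.le_M, ?_, h.X_eq, h.X_zero, h.start, ?_, ?_, h.prev, ?_,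
    ?_⟩
  · show 1 ≤ σ.i - 1
    omega
  · show σ.i - 1 ≤ k
    omega
  · exact h.one_le_cnt.trans (h.tree.cnt_anti (j := σ.i - 1) (by omega) (by omega))
  · rw [h.trail_head σ.i hi le_rfl] at hp
    exact (Option.some.inj hp).symm
  · intro j hj hjk
    have hj' : σ.i - 1 < j := hj
    -- The fence that the robot leaves joins those below the current one, and it is not ahead since
    -- `Case2` did not apply.
    by_cases hji : j = σ.i
    · subst hji
      exact X_le_of_not_case2 h2 hjk
    · exact h.order j (by omega) hjk
  · intro _
    show σ.M (σ.i - 1 + 1) < M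
    rw [Nat.sub_add_cancel h.one_le_i]
    exact h.lt_of_not_case5 h4 h5
  · intro j hj hji
    have hji' : j ≤ σ.i - 1 := hji
    exact h.trail_head j hj (by omega)

lemma case1 (h : Inv S τ k M P₀ σ) (h1 : Case1 k σ) {path : List Point} {p : Point}
    (hp : GoBackDown S τ σ.post σ.branch σ.i (σ.M σ.i) (σ.M (σ.i + 1)) σ.pos path p) :
    Inv S τ k M P₀ (σ.goDown path p) := by
  have hq := h.one_le_of_case1 h1
  exact h.goDown h1.1 hq (hp.end_eq (h.tree.branch_spec (by omega) hq le_rfl).1)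
    (hp.head?_eq (h.tree.branch_spec h.one_le_i h.one_le_cnt le_rfl).1)

lemma case2 (h : Inv S τ k M P₀ σ) (hpos : 0 < P₀.1) (h1 : ¬ Case1 k σ) (h2 : Case2 k σ)
    {path : List Point} {p : Point} (hp : DownEdge S τ σ.pos path p) (hn : p.1 ≠ S.n) :
    Inv S τ k M P₀ (σ.addPost (σ.i + 1) path p path) := by
  have hc := h.cnt_of_case2 h1 h2
  rw [h.pos_eq] at hp
  obtain ⟨l, hl, rfl⟩ := hp
  obtain ⟨g1, g2, g3⟩ := hl.wall_or_post.resolve_left hn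
  have hi := h.one_le_i
  refine h.addPost hpos (by omega) le_rfl h2.1 (Or.inr (by simp [hc])) (Or.inr (by omega))
    (h.order _ (by omega)) ?_ g1 g2 ?_ hl.edge_getLast? (by simp) (Or.inr ⟨by omega, ?_, ?_, ?_⟩)
  · intro _
    exact (h.tree.anti (σ.i + 1) (by omega)).trans_lt (h.unfinished h2.1)
  · rw [g3]
    simp only
    rw [h.tree.height hi h.one_le_cnt le_rfl, hc]
    push_cast
    ring
  -- For a post that is not the first of its fence, the parent rule is the inequality of `Case2`.
  · rcases Nat.eq_zero_or_pos (σ.M (σ.i + 1)) with h0 | h0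
    · exact Or.inl (by omega)
    · right
      rw [← h.X_eq (σ.i + 1) (by omega) h0, Nat.add_sub_cancel, ← hc, ← h.X_eq σ.i hi h.one_le_cnt]
      exact h2.2
  · rw [Nat.add_sub_cancel, ← hc]
    exact ⟨l, hl, rfl⟩
  · rw [Nat.add_sub_cancel, ← hc]

lemma case3 (h : Inv S τ k M P₀ σ) (hpos : 0 < P₀.1) (h2 : ¬ Case2 k σ) (h3 : Case3 M σ)
    {path : List Point} {p : Point} (hp : UpEdge S τ σ.pos path p) (hn : p.1 ≠ S.n) :
    Inv S τ k M P₀ (σ.addPost σ.i path p (σ.trail σ.i ++ path)) := by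
  rw [h.pos_eq] at hp
  obtain ⟨l, hl, rfl⟩ := hp
  obtain ⟨g1, g2, g3⟩ := hl.wall_or_post.resolve_left hn
  have hi := h.one_le_i
  have hc := h.one_le_cnt
  refine h.addPost hpos le_rfl (by omega) h.i_le ?_ ?_ (X_le_of_not_case2 h2) h.unfinished g1 g2 ?_
    hl.edge_getLast? ?_ (Or.inl ⟨by omega, ?_, ⟨l, hl, rfl⟩, rfl⟩)
  · rcases h3 with ⟨h3, -⟩ | ⟨-, h3⟩
    · exact Or.inl h3
    · exact Or.inr (by rcases h3 with h3 | ⟨h3, -⟩ <;> omega)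
  · rcases h3 with ⟨h3, h3'⟩ | ⟨h3, -⟩
    · exact Or.inl (by rwa [h3] at h3')
    · exact Or.inr (by omega)
  · rw [g3]
    simp only
    rw [h.tree.height hi hc le_rfl]
    push_cast
    ring
  · intro hi2
    rw [List.head?_append, h.trail_head σ.i hi2 le_rfl]
    rfl
  · rcases h3 with ⟨h3, -⟩ | ⟨h3, h3'⟩
    · exact Or.inl h3
    right
    rw [← h.X_eq σ.i hi hc]
    -- If at least two posts are lacking, the post above the new one is not the last of its fence,
    -- and `prev` applies. If one is lacking, the parent rule is the condition of `Case3`.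
    rcases h3' with h3' | ⟨h3', h3''⟩
    · have hprev := h.prev (σ.i - 1) (by omega) (by have := h.i_le; omega) (by omega)
      rw [Nat.sub_add_cancel hi] at hprev
      exact (h.tree.le_right_of_le (by omega) (by omega) (by omega) (by omega)).trans hprev
    · rw [h.X_eq (σ.i - 1) (by omega) (by omega), h3'] at h3''
      exact h3''

lemma case4 (h : Inv S τ k M P₀ σ) (hpos : 0 < P₀.1) (h2 : ¬ Case2 k σ) (h4 : Case4 k M σ)
    {path : List Point} {p : Point}
    (hp : GoDown S τ σ.post σ.branch σ.i (σ.M σ.i) (σ.M (σ.i + 1)) σ.pos path p) :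
    Inv S τ k M P₀ (σ.goDown path p) := by
  have hq := h.one_le_of_X_le hpos h.one_le_i h.one_le_cnt (X_le_of_not_case2 h2 h4.1)
  exact h.goDown h4.1 hq (hp.end_eq (h.tree.branch_spec (by omega) hq le_rfl).1) hp.head?_eq

lemma halt (h : Inv S τ k M P₀ σ) : Inv S τ k M P₀ { σ with halted := true } :=
  ⟨h.tree, h.one_le_i, h.i_le, h.le_M, h.one_le_cnt, h.X_eq, h.X_zero, h.start, h.pos_eq, h.order,
    h.prev, h.unfinished, h.trail_head⟩

end Inv

/-- What holds at any time in any run. -/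
def Sound (S : Scene) (τ : ℝ) (k M : ℕ) (P₀ : Point) (σ : State) : Prop :=
  (σ.halted = false ∧ Inv S τ k M P₀ σ) ∨
  -- At the wall the robot is not at a post, so the invariant is given up there.
  (σ.halted = true ∧ (σ.pos.1 = S.n ∨ (Inv S τ k M P₀ σ ∧ Case5 k M σ)))

lemma Sound.inv {S : Scene} {τ : ℝ} {k M : ℕ} {P₀ : Point} {σ : State}
    (h : Sound S τ k M P₀ σ) (hh : σ.halted = false) : Inv S τ k M P₀ σ := by
  rcases h with h | h
  · exact h.2
  · rw [h.1] at hh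
    exact absurd hh (by simp)

lemma Step.not_halted {S : Scene} {τ : ℝ} {k M : ℕ} {σ σ' : State} (h : Step S τ k M σ σ') :
    σ.halted = false := by
  cases h <;> assumption

lemma Sound.step {S : Scene} {τ : ℝ} {k M : ℕ} {P₀ : Point} (hpos : 0 < P₀.1) {σ σ' : State}
    (h : Sound S τ k M P₀ σ) (hs : Step S τ k M σ σ') : Sound S τ k M P₀ σ' := by
  have hI := h.inv hs.not_halted
  cases hs with
  | case1 path p hh h1 hp => exact Or.inl ⟨hh, hI.case1 h1 hp⟩
  | case2 path p hh h1 h2 hp hn => exact Or.inl ⟨hh, hI.case2 hpos h1 h2 hp hn⟩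
  | case2Wall path p hh h1 h2 hp hn => exact Or.inr ⟨rfl, Or.inl hn⟩
  | case3 path p hh h1 h2 h3 hp hn => exact Or.inl ⟨hh, hI.case3 hpos h2 h3 hp hn⟩
  | case3Wall path p hh h1 h2 h3 hp hn => exact Or.inr ⟨rfl, Or.inl hn⟩
  | case4 path p hh h1 h2 h3 h4 hp => exact Or.inl ⟨hh, hI.case4 hpos h2 h4 hp⟩
  | case5 hh h1 h2 h3 h4 h5 => exact Or.inr ⟨rfl, Or.inr ⟨hI.halt, h5⟩⟩
  | case6 p hh h1 h2 h3 h4 h5 hi hp => exact Or.inl ⟨hh, hI.goUp h2 h4 h5 hi hp⟩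

/-! ### Termination -/

/-- The number of posts that have not been found. -/
def missing (k M : ℕ) (σ : State) : ℕ := ∑ j ∈ Finset.Icc 1 k, (M - σ.M j)

open Classical in
/-- A bound for the number of steps until the procedure halts. -/
noncomputable def fuel (k M : ℕ) (σ : State) : ℕ :=
  if σ.halted then 0 else
    -- A new post lowers the middle term by `2 * (k + 1)`, which outweighs the last term, at most `2
    -- * k + 1`. A descent makes the last term `0`, since `Case3` comes next, and a return lowers
    -- `σ.i`.
    1 + 2 * (k + 1) * missing k M σ +
      if ¬ Case1 k σ ∧ ¬ Case2 k σ ∧ Case3 M σ then 0 else k + 1 + σ.i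

lemma missing_addPost {k M : ℕ} {σ : State} {j : ℕ} (hj : 1 ≤ j) (hjk : j ≤ k) (hM : σ.M j < M)
    (path : List Point) (p : Point) (t : List Point) :
    missing k M (σ.addPost j path p t) + 1 = missing k M σ := by
  have hmem : j ∈ Finset.Icc 1 k := Finset.mem_Icc.2 ⟨hj, hjk⟩
  unfold missing
  rw [← Finset.add_sum_erase _ _ hmem, ← Finset.add_sum_erase (a := j) _ _ hmem]
  have : ∑ x ∈ (Finset.Icc 1 k).erase j, (M - (σ.addPost j path p t).M x) =
      ∑ x ∈ (Finset.Icc 1 k).erase j, (M - σ.M x) := by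
    refine Finset.sum_congr rfl fun x hx => ?_
    simp [State.addPost, Function.update_of_ne (Finset.ne_of_mem_erase hx)]
  rw [this]
  simp only [State.addPost, Function.update_self]
  omega

lemma fuel_le {k M : ℕ} {σ : State} :
    fuel k M σ ≤ 1 + 2 * (k + 1) * missing k M σ + (k + 1 + σ.i) := by
  unfold fuel
  split_ifs <;> omega

lemma lt_fuel {k M : ℕ} {σ : State} (hh : σ.halted = false) :
    2 * (k + 1) * missing k M σ < fuel k M σ := by
  unfold fuel
  rw [hh]
  simp only [Bool.false_eq_true, if_false]
  omega

lemma fuel_of_not_case3 {k M : ℕ} {σ : State} (hh : σ.halted = false)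
    (h : ¬ (¬ Case1 k σ ∧ ¬ Case2 k σ ∧ Case3 M σ)) :
    fuel k M σ = 1 + 2 * (k + 1) * missing k M σ + (k + 1 + σ.i) := by
  unfold fuel
  rw [hh, if_neg h]
  simp

lemma fuel_addPost_lt {k M : ℕ} {σ : State} (hh : σ.halted = false) {j : ℕ} (hj : 1 ≤ j)
    (hjk : j ≤ k) (hM : σ.M j < M) (path : List Point) (p : Point) (t : List Point) :
    fuel k M (σ.addPost j path p t) < fuel k M σ := by
  have h1 := missing_addPost hj hjk hM path p t
  have h2 := lt_fuel (k := k) (M := M) hh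
  have h3 := fuel_le (k := k) (M := M) (σ := σ.addPost j path p t)
  rw [← h1] at h2
  have : (σ.addPost j path p t).i = j := rfl
  rw [this] at h3
  nlinarith

/-- The robot goes down to a fence only in order to extend it. -/
lemma fuel_goDown_lt {S : Scene} {τ : ℝ} {k M : ℕ} {P₀ : Point} {σ : State}
    (h : Inv S τ k M P₀ σ) (hh : σ.halted = false)
    (hσ : ¬ (¬ Case1 k σ ∧ ¬ Case2 k σ ∧ Case3 M σ))
    (hc : σ.M (σ.i + 1) + 1 < σ.M σ.i ∨
      (σ.M (σ.i + 1) < σ.M σ.i ∧ σ.X σ.i ≤ σ.X (σ.i + 1)))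
    (path : List Point) (p : Point) : fuel k M (σ.goDown path p) < fuel k M σ := by
  rw [fuel_of_not_case3 hh hσ]
  have h2 : ¬ Case2 k (σ.goDown path p) := by
    rintro ⟨a, b⟩
    exact absurd (h.order (σ.i + 1) (by omega) a) (not_le.2 b)
  have h1 : ¬ Case1 k (σ.goDown path p) := fun h => h2 ⟨h.1, h.2.1⟩
  have h3 : Case3 M (σ.goDown path p) := by
    have := h.one_le_i
    refine Or.inr ⟨by show 1 < σ.i + 1; omega, ?_⟩
    show σ.M (σ.i + 1) + 1 < σ.M (σ.i + 1 - 1) ∨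
      (σ.M (σ.i + 1 - 1) = σ.M (σ.i + 1) + 1 ∧ σ.X (σ.i + 1 - 1) ≤ σ.X (σ.i + 1))
    rw [Nat.add_sub_cancel]
    rcases hc with hc | ⟨hc, hX⟩
    · exact Or.inl hc
    · rcases Nat.lt_or_ge (σ.M (σ.i + 1) + 1) (σ.M σ.i) with h | h
      · exact Or.inl h
      · exact Or.inr ⟨by omega, hX⟩
  have e : missing k M (σ.goDown path p) = missing k M σ := rfl
  have hh' : (σ.goDown path p).halted = false := hh
  unfold fuel
  rw [hh', if_neg Bool.false_ne_true, if_pos ⟨h1, h2, h3⟩, e]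
  omega

lemma fuel_lt {S : Scene} {τ : ℝ} {k M : ℕ} {P₀ : Point} {σ σ' : State}
    (h : Inv S τ k M P₀ σ) (hs : Step S τ k M σ σ') : fuel k M σ' < fuel k M σ := by
  have halted_lt : ∀ {σ' : State}, σ'.halted = true → fuel k M σ' < fuel k M σ := by
    intro σ' hh
    have : fuel k M σ' = 0 := by simp [fuel, hh]
    rw [this]
    exact (Nat.zero_le _).trans_lt (lt_fuel hs.not_halted)
  cases hs with
  | case1 path p hh h1 hp => exact fuel_goDown_lt h hh (fun h => h.1 h1) (Or.inl h1.2.2) _ _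
  | case2 path p hh h1 h2 hp hn =>
    exact fuel_addPost_lt hh (by omega) h2.1 (h.unfinished h2.1) _ _ _
  | case2Wall path p hh h1 h2 hp hn => exact halted_lt rfl
  | case3 path p hh h1 h2 h3 hp hn =>
    refine fuel_addPost_lt hh h.one_le_i h.i_le ?_ _ _ _
    rcases h3 with ⟨-, h3⟩ | ⟨h3, h3'⟩
    · exact h3
    · have := h.cnt_le (j := σ.i - 1) (by omega)
      rcases h3' with h3' | ⟨h3', -⟩ <;> omega
  | case3Wall path p hh h1 h2 h3 hp hn => exact halted_lt rfl
  | case4 path p hh h1 h2 h3 h4 hp =>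
    exact fuel_goDown_lt h hh (fun h => h3 h.2.2)
      (Or.inr ⟨h4.2.1, Inv.X_le_of_not_case2 h2 h4.1⟩) _ _
  | case5 hh h1 h2 h3 h4 h5 => exact halted_lt rfl
  | case6 p hh h1 h2 h3 h4 h5 hi hp =>
    rw [fuel_of_not_case3 hh fun h => h3 h.2.2]
    refine fuel_le.trans_lt ?_
    have e : missing k M (σ.goUp p) = missing k M σ := rfl
    have e' : (σ.goUp p).i = σ.i - 1 := rfl
    rw [e, e']
    omega

/-! ### The tree at the end -/

/-- The lowest fence has `M` posts and no fence has fewer than the one below it, so all nodes and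
edges have been found. -/
lemma Inv.isFenceTree {S : Scene} {τ : ℝ} {k M : ℕ} {P₀ : Point} {σ : State}
    (h : Inv S τ k M P₀ σ) (h5 : Case5 k M σ) : IsFenceTree S τ k M P₀ σ.post ∧
      (∀ i ∈ Finset.Icc 1 k, ∀ m ∈ Finset.Icc 1 M, σ.post i m ∈ σ.walk) ∧
      ∀ i ∈ Finset.Icc 1 k, ∀ m ∈ Finset.Icc 1 M, (i, m) ≠ (1, 1) →
        ∃ path, EdgeInto S τ σ.post i m path ∧ path <:+: σ.walk := by
  have hcnt : ∀ i ∈ Finset.Icc 1 k, ∀ m ∈ Finset.Icc 1 M, 1 ≤ i ∧ 1 ≤ m ∧ m ≤ σ.M i := by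
    intro i hi m hm
    rw [Finset.mem_Icc] at hi hm
    have := h.tree.cnt_anti hi.1 hi.2
    rw [← h5.1, h5.2] at this
    exact ⟨hi.1, hm.1, hm.2.trans this⟩
  have hedge : ∀ i ∈ Finset.Icc 1 k, ∀ m ∈ Finset.Icc 1 M, (i, m) ≠ (1, 1) →
      ∃ path, EdgeInto S τ σ.post i m path ∧ path <:+: σ.walk := by
    intro i hi m hm hne
    obtain ⟨a, b, c⟩ := hcnt i hi m hm
    obtain ⟨path, hw, hp⟩ := h.tree.edge i m a b c hne
    refine ⟨path, ?_, hw⟩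
    rcases hp with ⟨h1, h2, h3, -⟩ | ⟨h1, h2, h3, -⟩
    · by_cases hi1 : i = 1
      · subst hi1
        exact Or.inl ⟨rfl, h3⟩
      · exact Or.inr (Or.inr (Or.inr ⟨hi1, by omega, h2.resolve_left hi1, h3⟩))
    · by_cases hm1 : m = 1
      · subst hm1
        exact Or.inr (Or.inl ⟨by omega, rfl, h3⟩)
      · exact Or.inr (Or.inr (Or.inl ⟨by omega, hm1, h2.resolve_left hm1, h3⟩))
  refine ⟨⟨h.tree.root.1, ?_, ?_⟩, ?_, hedge⟩
  · intro i hi m hm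
    obtain ⟨a, b, c⟩ := hcnt i hi m hm
    exact ⟨(h.tree.node i m a b c).1, (h.tree.node i m a b c).2.1⟩
  · intro i hi m hm hne
    obtain ⟨path, hp, -⟩ := hedge i hi m hm hne
    exact ⟨path, hp⟩
  · intro i hi m hm
    obtain ⟨a, b, c⟩ := hcnt i hi m hm
    exact (h.tree.node i m a b c).2.2.2

end State

end Nav

/-! ### Termination, progress and correctness of every run -/

theorem theorem3 (S : Nav.Scene) (τ : ℝ) (hτ : 0 < τ) (k M : ℕ) (hk : 1 ≤ k) (hM : 1 ≤ M)
    (P₀ : Nav.Point) (hpost : S.IsPost τ P₀) (hpos : 0 < P₀.1) (hwall : P₀.1 < S.n) :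
    -- there is no infinite run
    (¬ ∃ run : ℕ → Nav.State, run 0 = Nav.State.init P₀ ∧
      ∀ t, Nav.State.Step S τ k M (run t) (run (t + 1))) ∧
    -- no run gets stuck before the procedure halts
    (∀ σ, Nav.State.Reachable S τ k M P₀ σ → σ.halted = false →
      ∃ σ', Nav.State.Step S τ k M σ σ') ∧
    -- if the robot is not at the wall on termination, then the unique tree has been found
    (∀ σ, Nav.State.Reachable S τ k M P₀ σ → σ.halted = true → σ.pos.1 ≠ S.n →
      ∃ P : ℕ → ℕ → Nav.Point,
        Nav.IsFenceTree S τ k M P₀ P ∧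
        (∀ P', Nav.IsFenceTree S τ k M P₀ P' →
          ∀ i ∈ Finset.Icc 1 k, ∀ m ∈ Finset.Icc 1 M, P' i m = P i m) ∧
        σ.pos = P k M ∧
        (∀ i ∈ Finset.Icc 1 k, ∀ m ∈ Finset.Icc 1 M, P i m ∈ σ.walk) ∧
        (∀ i ∈ Finset.Icc 1 k, ∀ m ∈ Finset.Icc 1 M, (i, m) ≠ (1, 1) →
          ∃ path, Nav.EdgeInto S τ P i m path ∧ path <:+: σ.walk)) := by
  have hinit : Nav.State.Sound S τ k M P₀ (Nav.State.init P₀) :=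
    Or.inl ⟨rfl, Nav.State.inv_init hk hM hpost hwall⟩
  have hsound : ∀ σ, Nav.State.Reachable S τ k M P₀ σ → Nav.State.Sound S τ k M P₀ σ := by
    intro σ hσ
    induction hσ with
    | refl => exact hinit
    | tail _ hs ih => exact ih.step hpos hs
  refine ⟨?_, ?_, ?_⟩
  · rintro ⟨run, h0, hrun⟩
    have hs : ∀ t, Nav.State.Sound S τ k M P₀ (run t) := by
      intro t
      induction t with
      | zero => rwa [h0]
      | succ t ih => exact ih.step hpos (hrun t)
    -- Every step consumes fuel, so the initial fuel bounds the length of a run.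
    have hlt : ∀ t, Nav.State.fuel k M (run t) + t ≤ Nav.State.fuel k M (run 0) := by
      intro t
      induction t with
      | zero => rfl
      | succ t ih =>
        have := Nav.State.fuel_lt ((hs t).inv (hrun t).not_halted) (hrun t)
        omega
    have := hlt (Nav.State.fuel k M (run 0) + 1)
    omega
  · intro σ hσ hh
    exact ((hsound σ hσ).inv hh).exists_step hτ hpos hh
  · intro σ hσ hh hn
    rcases hsound σ hσ with ⟨h, -⟩ | ⟨-, h⟩
    · rw [hh] at h
      exact absurd h (by simp)
    obtain ⟨hI, h5⟩ := h.resolve_left hn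
    obtain ⟨h1, h2, h3⟩ := hI.isFenceTree h5
    refine ⟨σ.post, h1, fun P' hP' i hi m hm => h1.unique hP' hi hm, ?_, h2, h3⟩
    rw [hI.pos_eq, h5.2, h5.1]
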